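/- **Generalised Jacobi–Trudy expansion of factorial Grothendieck polynomials.** Let $K$ be a field, $\beta\in K$, $t=(t_j)_{j\in\mathbb Z}$ a sequence in $K$ with $1+\beta t_j\neq0$ for all $j$, and $x=(x_1,\dots,x_n)$ pairwise distinct elements of $K$ (for instance, all of these independent indeterminates and $K$ a field of rational functions in them). Put $$x\oplus y=x+y+\beta xy,\qquad x\ominus y=\frac{x-y}{1+\beta y},\qquad (\ominus t)_j=0\ominus t_j,\qquad (\tau^m t)_j=t_{j+m},\qquad (u|t)^r=\prod_{i=1}^r (u\oplus t_i).$$ For a finite set $\theta$ of boxes (a Young diagram), the factorial Grothendieck polynomial is $$G_\theta(x|t)=\sum_T\beta^{|T|-|\theta|}\prod_{(i,j)\in\theta,\ r\in T(i,j)} x_r\oplus t_{r+j-i},$$ the sum being over all set-valued tableaux $T$ of shape $\theta$: each box carries a nonempty subset $T(i,j)\subset\{1,\dots,n\}$ with $\max T(i,j)\le\min T(i,j+1)$ and $\max T(i,j)<\min T(i+1,j)$ whenever both boxes lie in $\theta$, and $|T|=\sum_{(i,j)\in\theta}|T(i,j)|$. For a composition $\mu=(\mu_1,\dots,\mu_n)$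 (nonnegative integers in any order) put $$F_\mu(x|t)=\frac{\det[(x_j|t)^{n+\mu_i-i}]_{1\le i,j\le n}}{\det[(x_j|t)^{n-i}]_{1\le i,j\le n}}.$$ For $0\le i\le r$ and $m\in\mathbb Z$ let $$\Gamma_i(r,m)=\beta^{r-i}\prod_{j=i}^{r-1}(1+\beta t_{m-j})\sum_{i-1\le j_1\le\cdots\le j_i\le r-1}\ \prod_{l=1}^{i}(1+\beta t_{m-j_l})$$ (for $i=0$ the last sum is $1$). Let $\lambda$ be a partition with at most $n$ parts. Then the denominator of $F_\mu(x|\ominus t)$ is nonzero and $$G_\lambda(x|\ominus t)=\sum_{\alpha}\beta^{|\alpha|}\,\phi_\alpha(\lambda)\,F_{\lambda+\alpha}(x|\ominus t),$$ where $\alpha=(0,\alpha_2,\dots,\alpha_n)$ runs over all compositions with $0\le\alpha_i\le i-1$ and $$\phi_\alpha(\lambda)=\frac{\prod_{i=2}^n\varphi_{\alpha_i}(\lambda_i)}{\prod_{i=1}^n(1+\beta t_i)^{n-i}},\qquad \beta^{\alpha_i}\varphi_{\alpha_i}(\lambda_i)=\Gamma_{i-1-\alpha_i}(i-1,\,n+\lambda_i-1);$$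 here $\varphi_{\alpha_i}(\lambda_i)$ is obtained from the formula for $\Gamma_{i-1-\alpha_i}(i-1,n+\lambda_i-1)$ by deleting the explicit factor $\beta^{\alpha_i}$. Moreover, for every composition $\mu=(\mu_1,\dots,\mu_n)$, the ratio $F_\mu$ is, up to an explicit factor, a Jacobi–Trudy determinant in the $G_r$: $$\prod_{i=1}^n(1+\beta x_i)^{n-1}\;F_\mu(x|\ominus t)=\prod_{i=1}^{n}\bigl((1+\beta t_i)(1+\beta t_{1-i})\bigr)^{n-i}\;\det\bigl[G_{\mu_i-i+j}(x|\tau^{1-j}(\ominus t))\bigr]_{1\le i,j\le n},$$ where $G_r$, $r\ge0$, is the factorial Grothendieck polynomial of the one-row partition $(r)$, and for $-n<r<0$ one sets $G_r(x|t)=\sum_{i=1}^n (x_i|t)^{n+r-1}\prod_{j\ne i}\frac{1}{x_i\ominus x_j}$ with $\frac1{x_i\ominus x_j}=\frac{1+\beta x_j}{x_i-x_j}$. -/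

import Mathlib

/-- The multiplicative formal group law `x ⊕ y = x + y + β x y`. -/
def fglAdd {K : Type*} [Field K] (β x y : K) : K := x + y + β * x * y

/-- The formal difference `x ⊖ y = (x - y) / (1 + β y)`. -/
def fglSub {K : Type*} [Field K] (β x y : K) : K := (x - y) / (1 + β * y)

/-- The sequence `⊖t`, i.e. `(⊖t)_j = 0 ⊖ t_j`. -/
def fglNeg {K : Type*} [Field K] (β : K) (t : ℤ → K) : ℤ → K := fun j => fglSub β 0 (t j)

/-- The shifted sequence `(τ^m t)_j = t_{j+m}`. -/
def shiftSeq {K : Type*} (m : ℤ) (t : ℤ → K) : ℤ → K := fun j => t (j + m)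

/-- The `β`-deformed factorial power `(u|t)^r = ∏_{i=1}^r (u ⊕ t_i)`. -/
def facPow {K : Type*} [Field K] (β : K) (t : ℤ → K) (u : K) (r : ℕ) : K :=
  ∏ i ∈ Finset.Icc 1 r, fglAdd β u (t (i : ℤ))

/-- Set-valued tableaux with entries in `{1, …, n}` on a finite set `θ` of boxes
`(row, column)`; rows and columns are numbered from `0`, and `r : Fin n` stands for the
entry `r + 1`. Every box carries a nonempty set, with `max T(i,j) ≤ min T(i,j+1)` and
`max T(i,j) < min T(i+1,j)` whenever both boxes lie in `θ`. -/
def IsSetValuedTableau {n : ℕ} (θ : Finset (ℕ × ℕ)) (T : θ → Finset (Fin n)) : Prop :=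
  (∀ c, (T c).Nonempty) ∧
  (∀ c d : θ, d.1 = (c.1.1, c.1.2 + 1) → ∀ a ∈ T c, ∀ b ∈ T d, a ≤ b) ∧
  (∀ c d : θ, d.1 = (c.1.1 + 1, c.1.2) → ∀ a ∈ T c, ∀ b ∈ T d, a < b)

instance {n : ℕ} (θ : Finset (ℕ × ℕ)) :
    DecidablePred (IsSetValuedTableau (n := n) θ) := fun T => by
  unfold IsSetValuedTableau; infer_instance

/-- The factorial Grothendieck polynomial
`G_θ(x|t) = ∑_T β^{|T|-|θ|} ∏_{(i,j) ∈ θ, r ∈ T(i,j)} x_r ⊕ t_{r+j-i}`, the sum running over all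
set-valued tableaux of shape `θ`. As all sets in `T` are nonempty, `|T| ≥ |θ|`. -/
def facGroth {K : Type*} [Field K] {n : ℕ} (β : K) (x : Fin n → K) (t : ℤ → K)
    (θ : Finset (ℕ × ℕ)) : K :=
  ∑ T ∈ (Finset.univ : Finset (θ → Finset (Fin n))).filter (IsSetValuedTableau θ),
    β ^ ((∑ c, (T c).card) - θ.card) *
      ∏ c, ∏ r ∈ T c,
        fglAdd β (x r) (t (((r : ℕ) : ℤ) + 1 + ((c.1.2 : ℕ) : ℤ) - ((c.1.1 : ℕ) : ℤ)))

/-- `G_r(x|t)` for an integer `r`: for `r ≥ 0` the factorial Grothendieck polynomial of the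
one-row diagram with `r` boxes; for `r < 0` (only `r > -n` is ever used) the value
`∑_i (x_i|t)^{n+r-1} ∏_{j ≠ i} 1 / (x_i ⊖ x_j)`, where
`1 / (x_i ⊖ x_j) = (1 + β x_j) / (x_i - x_j)`. -/
def facGrothRow {K : Type*} [Field K] {n : ℕ} (β : K) (x : Fin n → K) (t : ℤ → K)
    (r : ℤ) : K :=
  if 0 ≤ r then facGroth β x t (({0} : Finset ℕ) ×ˢ Finset.range r.toNat)
  else ∑ i, facPow β t (x i) ((n : ℤ) + r - 1).toNat *
    ∏ j ∈ Finset.univ.erase i, (1 + β * x j) / (x i - x j)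

/-- `det [(x_j|t)^{n + μ_i - i}]`, rows and columns numbered `1, …, n` in the formula and
`0, …, n - 1` in the code. -/
def facPowDet {K : Type*} [Field K] {n : ℕ} (β : K) (x : Fin n → K) (t : ℤ → K)
    (μ : Fin n → ℕ) : K :=
  (Matrix.of fun i j : Fin n => facPow β t (x j) (μ i + (n - 1 - (i : ℕ)))).det

/-- `F_μ(x|t) = det [(x_j|t)^{n + μ_i - i}] / det [(x_j|t)^{n - i}]`, for any composition `μ`. -/
def facF {K : Type*} [Field K] {n : ℕ} (β : K) (x : Fin n → K) (t : ℤ → K)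
    (μ : Fin n → ℕ) : K :=
  facPowDet β x t μ / facPowDet β x t (fun _ => 0)

/-- The coefficient `Γ_i(r,m)` without its power of `β`:
`∏_{j=i}^{r-1} (1 + β t_{m-j}) ∑_{i-1 ≤ j_1 ≤ ⋯ ≤ j_i ≤ r-1} ∏_{l=1}^i (1 + β t_{m-j_l})`.
For `i = 0` the sum has one term, the empty product. -/
def gammaReduced {K : Type*} [Field K] (β : K) (t : ℤ → K) (i r : ℕ) (m : ℤ) : K :=
  (∏ j ∈ Finset.Ico i r, (1 + β * t (m - (j : ℤ)))) *
    ∑ J ∈ (Fintype.piFinset (fun _ : Fin i => Finset.Ico (i - 1) r)).filter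
        (fun J => ∀ k l : Fin i, k ≤ l → J k ≤ J l),
      ∏ l, (1 + β * t (m - (J l : ℤ)))

/-- The coefficient `Γ_i(r,m)`, for `0 ≤ i ≤ r`. -/
def gammaCoeff {K : Type*} [Field K] (β : K) (t : ℤ → K) (i r : ℕ) (m : ℤ) : K :=
  β ^ (r - i) * gammaReduced β t i r m

/-- `φ_a(λ_i)`, where `β^a φ_a(λ_i) = Γ_{i-1-a}(i-1, n + λ_i - 1)` for `0 ≤ a ≤ i - 1`. The code
numbers the rows from `0`, so that its `i` is the `i - 1` of the formula, and `p` is `λ_i`. -/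
def varphiCoeff {K : Type*} [Field K] (β : K) (t : ℤ → K) (n i a p : ℕ) : K :=
  gammaReduced β t (i - a) i ((n : ℤ) + (p : ℤ) - 1)

theorem pow_mul_varphiCoeff {K : Type*} [Field K] (β : K) (t : ℤ → K) (n i a p : ℕ)
    (h : a ≤ i) :
    β ^ a * varphiCoeff β t n i a p = gammaCoeff β t (i - a) i ((n : ℤ) + (p : ℤ) - 1) := by
  unfold varphiCoeff gammaCoeff
  rw [Nat.sub_sub_self h]

/-- `φ_α(λ) = ∏_{i=2}^n φ_{α_i}(λ_i) / ∏_{i=1}^n (1 + β t_i)^{n-i}`. -/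
def phiCoeff {K : Type*} [Field K] {n : ℕ} (β : K) (t : ℤ → K) (α lam : Fin n → ℕ) : K :=
  (∏ i ∈ Finset.univ.filter (fun i : Fin n => 1 ≤ (i : ℕ)),
      varphiCoeff β t n (i : ℕ) (α i) (lam i)) /
    ∏ i : Fin n, (1 + β * t (((i : ℕ) : ℤ) + 1)) ^ (n - 1 - (i : ℕ))

/-! The core is the determinantal formula `facGroth_rowCells_mul_vandermondeProd`: G_λ(x|t) times
∏_{i<j}(x_i − x_j) equals det[(x_j|t)^{λ_i+n−i} (1+βx_j)^{i−1}]. It goes by induction on n. Deleting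
the last letter of a set-valued tableau gives a branching rule over interlacing row lengths
(`facGroth_rowCells_succ`). On the other side, row operations clear the column of x_n and leave
entries that are sums over the possible lengths of one row (`sub_mul_branchRow`), so multilinearity
gives the same recursion.

For ⊖t one has (1+βx)(x|⊖t)^p = (1+βt_{p+1})((x|⊖t)^p + β(x|⊖t)^{p+1}). Iterating this i−1 times
expands row i in factorial powers, the coefficients Γ being products of factors 1+βt_k times
complete homogeneous polynomials in them. Multilinearity turns the determinant into the sum over α;
the denominator of F is a Vandermonde product up to a nonzero factor.

For Jacobi–Trudy, the determinantal formula of a one-row shape, expanded along its first row, writes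
G_r as a sum over the variables x_k. Shifting t splits off from each factorial power a factor
depending only on j and k. The matrix of the G's is therefore the numerator matrix of F_μ times a
diagonal matrix times a matrix whose determinant is again Vandermonde up to a factor. -/

/-! ### Branching of set-valued tableaux at the last letter -/

/-- The subset of `Fin (n + 1)` with trace `S` on `Fin n`, containing the last element iff `p`. -/
def extendLast {n : ℕ} (S : Finset (Fin n)) (p : Prop) [Decidable p] : Finset (Fin (n + 1)) :=
  S.map Fin.castSuccEmb ∪ if p then {Fin.last n} else ∅

section extendLast
variable {n : ℕ} (S : Finset (Fin n)) (p : Prop) [Decidable p]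

@[simp] theorem castSucc_mem_extendLast (a : Fin n) : a.castSucc ∈ extendLast S p ↔ a ∈ S := by
  by_cases h : p <;> simp [extendLast, h, Fin.castSucc_ne_last]

@[simp] theorem last_mem_extendLast : Fin.last n ∈ extendLast S p ↔ p := by
  by_cases h : p <;> simp [extendLast, h, Fin.castSucc_ne_last]

theorem disjoint_map_castSucc :
    Disjoint (S.map Fin.castSuccEmb) (if p then {Fin.last n} else ∅) := by
  by_cases h : p <;> simp [h, Fin.castSucc_ne_last]

theorem prod_extendLast {M : Type*} [CommMonoid M] (f : Fin (n + 1) → M) :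
    ∏ r ∈ extendLast S p, f r = (∏ r ∈ S, f r.castSucc) * if p then f (Fin.last n) else 1 := by
  rw [extendLast, Finset.prod_union (disjoint_map_castSucc S p), Finset.prod_map]
  by_cases h : p <;> simp [h]

end extendLast

/-- The cells of `μ` whose right neighbour is not in `μ` and whose lower neighbour is not in `θ`. -/
def branchCorners (θ μ : Finset (ℕ × ℕ)) : Finset (ℕ × ℕ) :=
  μ.filter fun c => (c.1, c.2 + 1) ∉ μ ∧ (c.1 + 1, c.2) ∉ θ

/-- The subsets of `θ` on which the restriction of a set-valued tableau of shape `θ` to all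
letters but the last one can live. -/
def branchShapes (θ : Finset (ℕ × ℕ)) : Finset (Finset (ℕ × ℕ)) :=
  θ.powerset.filter fun μ => ∀ c ∈ θ \ μ, (c.1, c.2 + 1) ∉ μ ∧ (c.1 + 1, c.2) ∉ θ

/-- The set-valued tableau glued from its restriction `T` to all letters but the last one, of shape
`μ`, and the set `S` of cells containing the last letter together with another one. -/
def glueTableau {n : ℕ} (θ μ S : Finset (ℕ × ℕ)) (T : μ → Finset (Fin n)) :
    θ → Finset (Fin (n + 1)) := fun c =>
  extendLast (if h : c.1 ∈ μ then T ⟨c.1, h⟩ else ∅) (c.1 ∉ μ ∨ c.1 ∈ S)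

/-- The last letter is the maximum, so it can only do harm in a cell whose right neighbour holds a
smaller letter or which has a cell below it. Both are excluded by the definitions of `branchShapes`
and `branchCorners`. -/
theorem isSetValuedTableau_glueTableau {n : ℕ} {θ μ S : Finset (ℕ × ℕ)} {T : μ → Finset (Fin n)}
    (hμ : μ ∈ branchShapes θ) (hS : S ⊆ branchCorners θ μ) (hT : IsSetValuedTableau μ T) :
    IsSetValuedTableau θ (glueTableau θ μ S T) := by
  obtain ⟨h1, h2, h3⟩ := hT
  simp only [branchShapes, Finset.mem_filter, Finset.mem_powerset, Finset.mem_sdiff] at hμ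
  obtain ⟨hμθ, hμ⟩ := hμ
  have hN : ∀ c : θ, (c.1 ∉ μ ∨ c.1 ∈ S) → (c.1.1, c.1.2 + 1) ∉ μ ∧ (c.1.1 + 1, c.1.2) ∉ θ := by
    rintro c (hc | hc)
    · exact hμ c.1 ⟨c.2, hc⟩
    · exact (Finset.mem_filter.1 (hS hc)).2
  refine ⟨fun c => ?_, fun c d hcd a ha b hb => ?_, fun c d hcd a ha b hb => ?_⟩
  · by_cases hc : c.1 ∈ μ
    · obtain ⟨a, ha⟩ := h1 ⟨c.1, hc⟩
      exact ⟨a.castSucc, by simp [glueTableau, hc, ha]⟩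
    · exact ⟨Fin.last n, by simp [glueTableau, hc]⟩
  · induction b using Fin.lastCases with
    | last => exact Fin.le_last a
    | cast b =>
      simp only [glueTableau, castSucc_mem_extendLast] at hb
      split_ifs at hb with hd
      swap; · simp at hb
      induction a using Fin.lastCases with
      | last =>
        simp only [glueTableau, last_mem_extendLast] at ha
        exact absurd (hcd ▸ hd) (hN c ha).1
      | cast a =>
        simp only [glueTableau, castSucc_mem_extendLast] at ha
        split_ifs at ha with hc
        swap; · simp at ha
        exact Fin.castSucc_le_castSucc_iff.2 (h2 ⟨c.1, hc⟩ ⟨d.1, hd⟩ hcd a ha b hb)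
  · induction a using Fin.lastCases with
    | last =>
      simp only [glueTableau, last_mem_extendLast] at ha
      exact absurd (hcd ▸ d.2) (hN c ha).2
    | cast a =>
      induction b using Fin.lastCases with
      | last => exact Fin.castSucc_lt_last a
      | cast b =>
        simp only [glueTableau, castSucc_mem_extendLast] at ha hb
        split_ifs at ha with hc
        swap; · simp at ha
        split_ifs at hb with hd
        swap; · simp at hb
        exact Fin.castSucc_lt_castSucc_iff.2 (h3 ⟨c.1, hc⟩ ⟨d.1, hd⟩ hcd a ha b hb)

theorem mem_iff_of_glueTableau {n : ℕ} {θ μ S : Finset (ℕ × ℕ)} {T : μ → Finset (Fin n)}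
    (hT : ∀ c, (T c).Nonempty) (c : θ) :
    c.1 ∈ μ ↔ ∃ a : Fin n, a.castSucc ∈ glueTableau θ μ S T c := by
  by_cases hc : c.1 ∈ μ
  · obtain ⟨a, ha⟩ := hT ⟨c.1, hc⟩
    simpa [glueTableau, hc] using ⟨a, ha⟩
  · simp [glueTableau, hc]

/-- The glued tableau determines μ as the set of cells holding some earlier letter, then S as the
cells of μ that also hold the last one. -/
theorem glueTableau_injective {n : ℕ} {θ μ μ' S S' : Finset (ℕ × ℕ)} {T : μ → Finset (Fin n)}
    {T' : μ' → Finset (Fin n)} (hμ : μ ⊆ θ) (hμ' : μ' ⊆ θ) (hS : S ⊆ μ) (hS' : S' ⊆ μ')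
    (hT : ∀ c, (T c).Nonempty) (hT' : ∀ c, (T' c).Nonempty)
    (h : glueTableau θ μ S T = glueTableau θ μ' S' T') :
    (⟨μ, (S, T)⟩ : Σ μ : Finset (ℕ × ℕ), Finset (ℕ × ℕ) × (μ → Finset (Fin n))) =
      ⟨μ', (S', T')⟩ := by
  obtain rfl : μ = μ' := by
    ext c
    by_cases hc : c ∈ θ
    · rw [mem_iff_of_glueTableau (S := S) hT ⟨c, hc⟩, h, ← mem_iff_of_glueTableau hT' ⟨c, hc⟩]
    · exact ⟨fun h' => absurd (hμ h') hc, fun h' => absurd (hμ' h') hc⟩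
  obtain rfl : S = S' := by
    ext c
    by_cases hc : c ∈ μ
    · have := congrArg (Fin.last n ∈ ·) (congrFun h ⟨c, hμ hc⟩)
      simpa [glueTableau, hc] using this
    · exact ⟨fun h' => absurd (hS h') hc, fun h' => absurd (hS' h') hc⟩
  obtain rfl : T = T' := by
    funext c
    ext a
    have := congrArg (a.castSucc ∈ ·) (congrFun h ⟨c.1, hμ c.2⟩)
    simpa [glueTableau, c.2] using this
  rfl

/-- Take for μ the cells holding an earlier letter, for N those holding the last letter, and S = μ ∩
N. -/
theorem exists_glueTableau_eq {n : ℕ} {θ : Finset (ℕ × ℕ)} {T : θ → Finset (Fin (n + 1))}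
    (hT : IsSetValuedTableau θ T) :
    ∃ μ ∈ branchShapes θ, ∃ S ⊆ branchCorners θ μ, ∃ T' : μ → Finset (Fin n),
      IsSetValuedTableau μ T' ∧ glueTableau θ μ S T' = T := by
  classical
  obtain ⟨h1, h2, h3⟩ := hT
  set μ : Finset (ℕ × ℕ) := θ.filter fun c => ∃ h : c ∈ θ, ∃ a : Fin n, a.castSucc ∈ T ⟨c, h⟩
    with hμ
  set N : Finset (ℕ × ℕ) := θ.filter fun c => ∃ h : c ∈ θ, Fin.last n ∈ T ⟨c, h⟩ with hN
  have hmemμ : ∀ c : θ, c.1 ∈ μ ↔ ∃ a : Fin n, a.castSucc ∈ T c := fun c => by simp [hμ, c.2]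
  have hmemN : ∀ c : θ, c.1 ∈ N ↔ Fin.last n ∈ T c := fun c => by simp [hN, c.2]
  have hμθ : μ ⊆ θ := Finset.filter_subset _ _
  have hor : ∀ c : θ, c.1 ∉ μ → c.1 ∈ N := fun c hc => by
    obtain ⟨a, ha⟩ := h1 c
    induction a using Fin.lastCases with
    | last => exact (hmemN c).2 ha
    | cast a => exact absurd ((hmemμ c).2 ⟨a, ha⟩) hc
  have hcorner : ∀ c : θ, c.1 ∈ N → (c.1.1, c.1.2 + 1) ∉ μ ∧ (c.1.1 + 1, c.1.2) ∉ θ := by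
    intro c hc
    rw [hmemN] at hc
    refine ⟨fun h => ?_, fun h => ?_⟩
    · obtain ⟨a, ha⟩ := (hmemμ ⟨_, hμθ h⟩).1 h
      exact absurd (h2 c ⟨_, hμθ h⟩ rfl _ hc _ ha) (not_le.2 (Fin.castSucc_lt_last a))
    · obtain ⟨a, ha⟩ := h1 ⟨_, h⟩
      exact absurd (h3 c ⟨_, h⟩ rfl _ hc _ ha) (not_lt.2 (Fin.le_last a))
  refine ⟨μ, ?_, μ ∩ N, ?_, fun c => Finset.univ.filter fun a => a.castSucc ∈ T ⟨c.1, hμθ c.2⟩,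
    ⟨fun c => ?_, fun c d hcd a ha b hb => ?_, fun c d hcd a ha b hb => ?_⟩, ?_⟩
  · simp only [branchShapes, Finset.mem_filter, Finset.mem_powerset, Finset.mem_sdiff]
    exact ⟨hμθ, fun c hc => hcorner ⟨c, hc.1⟩ (hor ⟨c, hc.1⟩ hc.2)⟩
  · intro c hc
    rw [Finset.mem_inter] at hc
    exact Finset.mem_filter.2 ⟨hc.1, hcorner ⟨c, hμθ hc.1⟩ hc.2⟩
  · obtain ⟨a, ha⟩ := (hmemμ ⟨c.1, hμθ c.2⟩).1 c.2
    exact ⟨a, by simpa using ha⟩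
  · simp only [Finset.mem_filter, Finset.mem_univ, true_and] at ha hb
    exact Fin.castSucc_le_castSucc_iff.1 (h2 ⟨c.1, hμθ c.2⟩ ⟨d.1, hμθ d.2⟩ hcd _ ha _ hb)
  · simp only [Finset.mem_filter, Finset.mem_univ, true_and] at ha hb
    exact Fin.castSucc_lt_castSucc_iff.1 (h3 ⟨c.1, hμθ c.2⟩ ⟨d.1, hμθ d.2⟩ hcd _ ha _ hb)
  · funext c
    ext a
    induction a using Fin.lastCases with
    | last =>
      rw [glueTableau, last_mem_extendLast, ← hmemN, Finset.mem_inter]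
      have := hor c
      tauto
    | cast a =>
      rw [glueTableau, castSucc_mem_extendLast]
      by_cases hc : c.1 ∈ μ
      · simp [hc]
      · simp only [hc, dite_false, Finset.notMem_empty, false_iff]
        exact fun h => hc ((hmemμ c).2 ⟨a, h⟩)

theorem prod_glueTableau {n : ℕ} {θ μ S : Finset (ℕ × ℕ)} {T : μ → Finset (Fin n)}
    (hμ : μ ⊆ θ) (hS : S ⊆ μ) {M : Type*} [CommMonoid M] (f : ℕ × ℕ → Fin (n + 1) → M) :
    ∏ c, ∏ r ∈ glueTableau θ μ S T c, f c.1 r =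
      (∏ c, ∏ r ∈ T c, f c.1 r.castSucc) *
        ((∏ c ∈ θ \ μ, f c (Fin.last n)) * ∏ c ∈ S, f c (Fin.last n)) := by
  -- A weight defined on all of ℕ × ℕ lets the products over subtypes be compared as products over
  -- finsets.
  obtain ⟨F, hF⟩ : ∃ F : ℕ × ℕ → M, F = fun c =>
    (if h : c ∈ μ then ∏ r ∈ T ⟨c, h⟩, f c r.castSucc else 1) *
      if c ∉ μ ∨ c ∈ S then f c (Fin.last n) else 1 := ⟨_, rfl⟩
  have h1 : ∀ c : θ, ∏ r ∈ glueTableau θ μ S T c, f c.1 r = F c.1 := by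
    intro c
    rw [glueTableau, prod_extendLast, hF]
    by_cases hc : c.1 ∈ μ <;> simp [hc]
  rw [Finset.prod_congr rfl fun c _ => h1 c, Finset.prod_coe_sort θ F, hF,
    Finset.prod_mul_distrib]
  congr 1
  · rw [← Finset.prod_subset hμ (fun c _ hc => by simp [hc]), ← Finset.prod_coe_sort μ fun c =>
      if h : c ∈ μ then ∏ r ∈ T ⟨c, h⟩, f c r.castSucc else 1]
    exact Finset.prod_congr rfl fun c _ => by simp [c.2]
  · rw [← Finset.prod_sdiff hμ]
    congr 1
    · exact Finset.prod_congr rfl fun c hc => by simp [(Finset.mem_sdiff.1 hc).2]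
    · rw [← Finset.prod_subset hS (fun c hc hcS => by simp [hc, hcS])]
      exact Finset.prod_congr rfl fun c hc => by simp [hc]

theorem sum_card_glueTableau {n : ℕ} {θ μ S : Finset (ℕ × ℕ)} {T : μ → Finset (Fin n)}
    (hμ : μ ⊆ θ) (hS : S ⊆ μ) :
    ∑ c, (glueTableau θ μ S T c).card = (∑ c, (T c).card) + ((θ \ μ).card + S.card) := by
  -- Counting entries is the multiplicative statement for the constant weight 1 in `Multiplicative
  -- ℕ`.
  have h := prod_glueTableau (T := T) hμ hS (fun _ _ => Multiplicative.ofAdd 1)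
  simpa [← ofAdd_sum, ← ofAdd_add, ← ofAdd_nsmul, Finset.prod_const] using
    congrArg Multiplicative.toAdd h

/-- Branching rule for factorial Grothendieck polynomials: splitting off the last variable. -/
theorem facGroth_succ {K : Type*} [Field K] {n : ℕ} (β : K) (x : Fin (n + 1) → K) (t : ℤ → K)
    (θ : Finset (ℕ × ℕ)) (u : ℕ × ℕ → K)
    (hu : ∀ c, u c = fglAdd β (x (Fin.last n)) (t ((n : ℤ) + 1 + (c.2 : ℤ) - (c.1 : ℤ)))) :
    facGroth β x t θ = ∑ μ ∈ branchShapes θ, facGroth β (fun i => x i.castSucc) t μ *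
      ((∏ c ∈ θ \ μ, u c) * ∏ c ∈ branchCorners θ μ, (1 + β * u c)) := by
  have hsub : ∀ {μ}, μ ∈ branchShapes θ → μ ⊆ θ := fun hμ =>
    Finset.mem_powerset.1 (Finset.mem_filter.1 hμ).1
  have hcor : ∀ {μ S}, S ⊆ branchCorners θ μ → S ⊆ μ := fun hS =>
    hS.trans (Finset.filter_subset _ _)
  symm
  -- Expanding ∏(1 + βu) over the corners makes the set S a summation index; gluing is then a
  -- weight-preserving bijection.
  calc _ = ∑ μ ∈ branchShapes θ, ∑ p ∈ (branchCorners θ μ).powerset ×ˢ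
            Finset.univ.filter (IsSetValuedTableau (n := n) μ),
          β ^ ((∑ c, (p.2 c).card) - μ.card) * (∏ c, ∏ r ∈ p.2 c,
            fglAdd β (x r.castSucc) (t (((r : ℕ) : ℤ) + 1 + (c.1.2 : ℤ) - (c.1.1 : ℤ)))) *
          ((∏ c ∈ θ \ μ, u c) * ∏ c ∈ p.1, (β * u c)) := by
        refine Finset.sum_congr rfl fun μ _ => ?_
        rw [Finset.sum_product_right, facGroth, Finset.prod_one_add, Finset.sum_mul]
        exact Finset.sum_congr rfl fun T _ => by rw [Finset.mul_sum, Finset.mul_sum]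
    _ = _ := by
        rw [Finset.sum_sigma', facGroth]
        refine Finset.sum_bij (fun p _ => glueTableau θ p.1 p.2.1 p.2.2) ?_ ?_ ?_ ?_
        · rintro ⟨μ, S, T⟩ h
          simp only [Finset.mem_sigma, Finset.mem_product, Finset.mem_powerset,
            Finset.mem_filter, Finset.mem_univ, true_and] at h ⊢
          exact isSetValuedTableau_glueTableau h.1 h.2.1 h.2.2
        · rintro ⟨μ, S, T⟩ h ⟨μ', S', T'⟩ h' heq
          simp only [Finset.mem_sigma, Finset.mem_product, Finset.mem_powerset,
            Finset.mem_filter, Finset.mem_univ, true_and] at h h'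
          exact glueTableau_injective (hsub h.1) (hsub h'.1) (hcor h.2.1) (hcor h'.2.1)
            h.2.2.1 h'.2.2.1 heq
        · intro T hT
          obtain ⟨μ, hμ, S, hS, T', hT', h⟩ := exists_glueTableau_eq (Finset.mem_filter.1 hT).2
          refine ⟨⟨μ, S, T'⟩, ?_, h⟩
          simp only [Finset.mem_sigma, Finset.mem_product, Finset.mem_powerset,
            Finset.mem_filter, Finset.mem_univ, true_and]
          exact ⟨hμ, hS, hT'⟩
        · rintro ⟨μ, S, T⟩ h
          simp only [Finset.mem_sigma, Finset.mem_product, Finset.mem_powerset,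
            Finset.mem_filter, Finset.mem_univ, true_and] at h
          obtain ⟨h1, h2, h3⟩ := h
          have hprod := prod_glueTableau (T := T) (hsub h1) (hcor h2) (fun c r =>
            fglAdd β (x r) (t (((r : ℕ) : ℤ) + 1 + (c.2 : ℤ) - (c.1 : ℤ))))
          -- Nonempty boxes make the truncated exponents of β genuine differences.
          have hcard : μ.card ≤ ∑ c, (T c).card := by
            calc μ.card = ∑ _c : μ, 1 := by simp
              _ ≤ _ := Finset.sum_le_sum fun c _ => Finset.card_pos.2 (h3.1 c)
          have hexp : (∑ c, (glueTableau θ μ S T c).card) - θ.card =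
              ((∑ c, (T c).card) - μ.card) + S.card := by
            rw [sum_card_glueTableau (hsub h1) (hcor h2)]
            have := Finset.card_sdiff_add_card_eq_card (hsub h1)
            omega
          simp only [hprod, hexp, Fin.val_last, Fin.val_castSucc, ← hu, pow_add,
            Finset.prod_mul_distrib, Finset.prod_const]
          ring

/-- A factorial Grothendieck polynomial vanishes if the first column is longer than the number of
variables. -/
theorem facGroth_eq_zero {K : Type*} [Field K] {n : ℕ} (β : K) (x : Fin n → K) (t : ℤ → K)
    (θ : Finset (ℕ × ℕ)) (h : ∀ i ≤ n, (i, 0) ∈ θ) : facGroth β x t θ = 0 := by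
  rw [facGroth, Finset.filter_false_of_mem, Finset.sum_empty]
  rintro T - ⟨h1, -, h3⟩
  -- Columns increase strictly, so row i of the first column only holds entries at least i; row n
  -- has none available.
  have key : ∀ i (hi : i ≤ n), ∀ a ∈ T ⟨(i, 0), h i hi⟩, i ≤ (a : ℕ) := by
    intro i
    induction i with
    | zero => exact fun _ _ _ => Nat.zero_le _
    | succ i ih =>
      intro hi a ha
      obtain ⟨b, hb⟩ := h1 ⟨(i, 0), h i (by omega)⟩
      have h4 := ih (by omega) b hb
      have h5 : (b : ℕ) < a := h3 ⟨(i, 0), h i (by omega)⟩ ⟨(i + 1, 0), h (i + 1) hi⟩ rfl b hb a ha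
      omega
  obtain ⟨a, ha⟩ := h1 ⟨(n, 0), h n le_rfl⟩
  have := key n le_rfl a ha
  omega

/-! ### Row lengths and interlacing -/

/-- The left-justified set of cells with row lengths `m`. -/
def rowCells {n : ℕ} (m : Fin n → ℕ) : Finset (ℕ × ℕ) :=
  (Finset.univ.sigma fun i : Fin n => Finset.range (m i)).map
    ⟨fun p => ((p.1 : ℕ), p.2), by
      rintro ⟨i, j⟩ ⟨i', j'⟩ h
      obtain ⟨h1, h2⟩ := Prod.mk.inj h
      obtain rfl := Fin.ext h1
      obtain rfl : j = j' := h2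
      rfl⟩

theorem mem_rowCells {n : ℕ} {m : Fin n → ℕ} {c : ℕ × ℕ} :
    c ∈ rowCells m ↔ ∃ h : c.1 < n, c.2 < m ⟨c.1, h⟩ := by
  simp only [rowCells, Finset.mem_map, Finset.mem_sigma, Finset.mem_univ, true_and,
    Finset.mem_range]
  constructor
  · rintro ⟨⟨i, j⟩, h, rfl⟩
    exact ⟨i.2, h⟩
  · rintro ⟨h, h'⟩
    exact ⟨⟨⟨c.1, h⟩, c.2⟩, h', rfl⟩

theorem mk_mem_rowCells {n : ℕ} {m : Fin n → ℕ} {i : Fin n} {j : ℕ} :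
    ((i : ℕ), j) ∈ rowCells m ↔ j < m i := by
  rw [mem_rowCells]
  exact ⟨fun ⟨_, h⟩ => h, fun h => ⟨i.2, h⟩⟩

theorem prod_rowCells {M : Type*} [CommMonoid M] {n : ℕ} (m : Fin n → ℕ) (f : ℕ × ℕ → M) :
    ∏ c ∈ rowCells m, f c = ∏ i, ∏ j ∈ Finset.range (m i), f (i, j) := by
  rw [rowCells, Finset.prod_map, Finset.prod_sigma]
  rfl

theorem rowCells_injective {n : ℕ} : Function.Injective (rowCells (n := n)) := by
  intro m m' h
  funext i
  exact eq_of_forall_lt_iff fun j => by rw [← mk_mem_rowCells, h, mk_mem_rowCells]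

/-- A downward closed proper set of natural numbers is an initial segment. -/
theorem exists_forall_iff_lt (P : ℕ → Prop) (h : ∃ j, ¬ P j) (hP : ∀ j, P (j + 1) → P j) :
    ∃ m, ∀ j, P j ↔ j < m := by
  classical
  refine ⟨Nat.find h, fun j => ⟨fun hj => ?_, fun hj => not_not.1 (Nat.find_min h hj)⟩⟩
  by_contra! hle
  have : ∀ k, P (Nat.find h + k) → P (Nat.find h) := by
    intro k
    induction k with
    | zero => exact id
    | succ k ih => exact fun hk => ih (hP _ hk)
  exact Nat.find_spec h (this (j - Nat.find h) (by rwa [Nat.add_sub_cancel' hle]))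

/-- The row lengths interlacing with `lam`. -/
def interlacing {n : ℕ} (lam : Fin (n + 1) → ℕ) : Finset (Fin n → ℕ) :=
  Fintype.piFinset fun i => Finset.Icc (lam i.succ) (lam i.castSucc)

theorem mem_interlacing {n : ℕ} {lam : Fin (n + 1) → ℕ} {m : Fin n → ℕ} :
    m ∈ interlacing lam ↔ ∀ i, lam i.succ ≤ m i ∧ m i ≤ lam i.castSucc := by
  simp [interlacing]

theorem antitone_of_mem_interlacing {n : ℕ} {lam : Fin (n + 1) → ℕ} (hlam : Antitone lam)
    {m : Fin n → ℕ} (hm : m ∈ interlacing lam) : Antitone m := by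
  intro i j hij
  rw [mem_interlacing] at hm
  rcases hij.eq_or_lt with rfl | hlt
  · exact le_rfl
  · exact ((hm j).2.trans (hlam (show i.succ ≤ j.castSucc from Fin.le_def.2 (by
      simpa using Nat.succ_le_of_lt (Fin.lt_def.1 hlt))))).trans (hm i).1

theorem succ_mk_mem_rowCells {n : ℕ} {lam : Fin (n + 1) → ℕ} {i : Fin n} {j : ℕ} :
    ((i : ℕ) + 1, j) ∈ rowCells lam ↔ j < lam i.succ := by
  rw [← mk_mem_rowCells, Fin.val_succ]

theorem castSucc_mk_mem_rowCells {n : ℕ} {lam : Fin (n + 1) → ℕ} {i : Fin n} {j : ℕ} :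
    ((i : ℕ), j) ∈ rowCells lam ↔ j < lam i.castSucc := by
  rw [← mk_mem_rowCells, Fin.val_castSucc]

theorem rowCells_mem_branchShapes {n : ℕ} {lam : Fin (n + 1) → ℕ} {m : Fin n → ℕ}
    (hm : m ∈ interlacing lam) : rowCells m ∈ branchShapes (rowCells lam) := by
  rw [mem_interlacing] at hm
  simp only [branchShapes, Finset.mem_filter, Finset.mem_powerset, Finset.mem_sdiff]
  refine ⟨fun c hc => ?_, fun c hc => ?_⟩
  · obtain ⟨h, h'⟩ := mem_rowCells.1 hc
    exact castSucc_mk_mem_rowCells.2 (h'.trans_le (hm ⟨c.1, h⟩).2)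
  · obtain ⟨c1, c2⟩ := c
    obtain ⟨hc, hc'⟩ := hc
    by_cases h : c1 < n
    · obtain ⟨i, rfl⟩ : ∃ i : Fin n, (i : ℕ) = c1 := ⟨⟨c1, h⟩, rfl⟩
      have := hm i
      simp only [succ_mk_mem_rowCells, mk_mem_rowCells] at *
      omega
    · refine ⟨fun h' => h (mem_rowCells.1 h').1, fun h' => ?_⟩
      have : c1 + 1 < n + 1 := (mem_rowCells.1 h').1
      omega

/-- A removed cell has no right neighbour in μ, so the rows of μ are left-closed. It has no cell of
the shape below it, which gives the lower interlacing bound. Left-closedness and `h0` leave row n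
empty. -/
theorem exists_rowCells_eq {n : ℕ} {lam : Fin (n + 1) → ℕ} (hlam : Antitone lam)
    {μ : Finset (ℕ × ℕ)} (hμ : μ ∈ branchShapes (rowCells lam)) (h0 : ((n, 0) : ℕ × ℕ) ∉ μ) :
    ∃ m ∈ interlacing lam, rowCells m = μ := by
  simp only [branchShapes, Finset.mem_filter, Finset.mem_powerset, Finset.mem_sdiff] at hμ
  obtain ⟨hsub, hμ⟩ := hμ
  have hleft : ∀ i j, (i, j + 1) ∈ μ → (i, j) ∈ μ := by
    intro i j h
    by_contra h'
    obtain ⟨h1, h2⟩ := mem_rowCells.1 (hsub h)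
    exact (hμ (i, j) ⟨mem_rowCells.2 ⟨h1, (Nat.lt_succ_self j).trans h2⟩, h'⟩).1 h
  have hrow : ∀ i : Fin n, ∃ k, ∀ j, ((i : ℕ), j) ∈ μ ↔ j < k := fun i =>
    exists_forall_iff_lt _ ⟨lam i.castSucc, fun h =>
      lt_irrefl _ (castSucc_mk_mem_rowCells.1 (hsub h))⟩ (hleft i)
  choose m hm using hrow
  refine ⟨m, mem_interlacing.2 fun i => ⟨?_, ?_⟩, ?_⟩
  · by_contra! h
    refine (hμ (i, m i) ⟨castSucc_mk_mem_rowCells.2 (h.trans_le (hlam ?_)), ?_⟩).2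
      (succ_mk_mem_rowCells.2 h)
    · exact (Fin.castSucc_lt_succ (i := i)).le
    · simp [hm]
  · by_contra! h
    exact lt_irrefl _ (castSucc_mk_mem_rowCells.1 (hsub ((hm i _).2 h)))
  · ext ⟨i, j⟩
    by_cases hi : i < n
    · exact (mk_mem_rowCells (i := ⟨i, hi⟩)).trans (hm ⟨i, hi⟩ j).symm
    · refine ⟨fun h => absurd (mem_rowCells.1 h).1 hi, fun h => ?_⟩
      have : i < n + 1 := (mem_rowCells.1 (hsub h)).1
      obtain rfl : i = n := by omega
      refine absurd ?_ h0
      clear hm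
      induction j with
      | zero => exact h
      | succ j ih => exact ih (hleft _ _ h)

theorem prod_sdiff_rowCells {M : Type*} [CommMonoid M] {n : ℕ} {lam : Fin (n + 1) → ℕ}
    {m : Fin n → ℕ} (u : ℕ × ℕ → M) :
    ∏ c ∈ rowCells lam \ rowCells m, u c =
      (∏ i : Fin n, ∏ j ∈ Finset.Ico (m i) (lam i.castSucc), u (i, j)) *
        ∏ j ∈ Finset.range (lam (Fin.last n)), u (n, j) := by
  rw [Finset.sdiff_eq_filter, Finset.prod_filter, prod_rowCells, Fin.prod_univ_castSucc]
  congr 1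
  · refine Finset.prod_congr rfl fun i _ => ?_
    simp only [Fin.val_castSucc, mk_mem_rowCells]
    rw [← Finset.prod_filter]
    refine Finset.prod_congr ?_ fun _ _ => rfl
    ext j
    simp only [Finset.mem_filter, Finset.mem_range, Finset.mem_Ico]
    omega
  · refine Finset.prod_congr rfl fun j _ => ?_
    rw [if_pos]
    · simp
    · rw [mem_rowCells]
      simp

/-- Only the last cell of a row can be a corner, and it is one when the next row of `lam` ends
before it. The condition forces `m i > 0`, so `m i - 1` is never truncated. -/
theorem prod_branchCorners_rowCells {M : Type*} [CommMonoid M] {n : ℕ} {lam : Fin (n + 1) → ℕ}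
    {m : Fin n → ℕ} (u : ℕ × ℕ → M) :
    ∏ c ∈ branchCorners (rowCells lam) (rowCells m), u c =
      ∏ i : Fin n, if lam i.succ < m i then u (i, m i - 1) else 1 := by
  rw [branchCorners, Finset.prod_filter, prod_rowCells]
  refine Finset.prod_congr rfl fun i _ => ?_
  simp only [mk_mem_rowCells, succ_mk_mem_rowCells]
  cases hk : m i with
  | zero => simp
  | succ k =>
    rw [Finset.prod_range_succ, Finset.prod_eq_one]
    · simp only [one_mul, Nat.add_sub_cancel, lt_irrefl, not_false_eq_true, true_and, not_lt,
        Nat.lt_succ_iff]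
    · intro j hj
      rw [Finset.mem_range] at hj
      rw [if_neg]
      omega

/-- The branching rule in terms of row lengths. -/
theorem facGroth_rowCells_succ {K : Type*} [Field K] {n : ℕ} (β : K) (x : Fin (n + 1) → K)
    (t : ℤ → K) {lam : Fin (n + 1) → ℕ} (hlam : Antitone lam) (u : ℕ × ℕ → K)
    (hu : ∀ c, u c = fglAdd β (x (Fin.last n)) (t ((n : ℤ) + 1 + (c.2 : ℤ) - (c.1 : ℤ)))) :
    facGroth β x t (rowCells lam) =
      (∏ j ∈ Finset.range (lam (Fin.last n)), u (n, j)) * ∑ m ∈ interlacing lam,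
        (∏ i : Fin n, (∏ j ∈ Finset.Ico (m i) (lam i.castSucc), u (i, j)) *
            if lam i.succ < m i then 1 + β * u (i, m i - 1) else 1) *
          facGroth β (fun i => x i.castSucc) t (rowCells m) := by
  rw [facGroth_succ β x t _ u hu, Finset.mul_sum]
  symm
  refine Finset.sum_of_injOn rowCells rowCells_injective.injOn
    (fun m hm => rowCells_mem_branchShapes hm) (fun μ hμ hμ' => ?_) (fun m _ => ?_)
  -- A branch shape not given by interlacing row lengths contains (n, 0). Its first column is then
  -- full, since a removed cell there would have a cell of the shape below it; n letters cannot fill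
  -- n + 1 boxes.
  · have h0 : ((n, 0) : ℕ × ℕ) ∈ μ := by
      by_contra h0
      obtain ⟨m, hm, h⟩ := exists_rowCells_eq hlam hμ h0
      exact hμ' ⟨m, hm, h⟩
    rw [facGroth_eq_zero, zero_mul]
    intro i hi
    simp only [branchShapes, Finset.mem_filter, Finset.mem_powerset, Finset.mem_sdiff] at hμ
    obtain ⟨_, hn⟩ := mem_rowCells.1 (hμ.1 h0)
    have hcol : ∀ j ≤ n, (j, 0) ∈ rowCells lam := fun j hj =>
      mem_rowCells.2 ⟨Nat.lt_succ_of_le hj, lt_of_lt_of_le hn (hlam hj)⟩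
    rcases hi.eq_or_lt with rfl | hlt
    · exact h0
    · by_contra h
      exact (hμ.2 (i, 0) ⟨hcol i hi, h⟩).2 (hcol (i + 1) hlt)
  · rw [prod_sdiff_rowCells, prod_branchCorners_rowCells (fun c => 1 + β * u c),
      Finset.prod_mul_distrib]
    ring

theorem YoungDiagram.cells_eq_rowCells (lam : YoungDiagram) {n : ℕ} (h : lam.colLen 0 ≤ n) :
    lam.cells = rowCells fun i : Fin n => lam.rowLen i := by
  ext ⟨i, j⟩
  rw [mem_rowCells, YoungDiagram.mem_cells]
  refine ⟨fun hc => ⟨?_, YoungDiagram.mem_iff_lt_rowLen.1 hc⟩,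
    fun ⟨_, hc⟩ => YoungDiagram.mem_iff_lt_rowLen.2 hc⟩
  exact (YoungDiagram.mem_iff_lt_colLen.1 (lam.up_left_mem le_rfl (Nat.zero_le j) hc)).trans_le h

/-! ### Factorial powers and the recursion for the determinant -/

/-- The factorial power `∏_{i<p} (x ⊕ b_i)` over a commutative ring. -/
def shiftedPow {R : Type*} [CommRing R] (β : R) (b : ℕ → R) (x : R) (p : ℕ) : R :=
  ∏ i ∈ Finset.range p, (x + b i + β * x * b i)

theorem facPow_eq_shiftedPow {K : Type*} [Field K] (β : K) (t : ℤ → K) (u : K) (r : ℕ) :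
    facPow β t u r = shiftedPow β (fun i => t ((i : ℤ) + 1)) u r := by
  rw [facPow, shiftedPow, Finset.range_eq_Ico, ← Finset.Ico_add_one_right_eq_Icc,
    ← Finset.prod_Ico_add' (fun i : ℕ => fglAdd β u (t (i : ℤ))) 0 r 1]
  exact Finset.prod_congr rfl fun i _ => by rw [Nat.cast_add, Nat.cast_one, fglAdd]

section CommRing
variable {R : Type*} [CommRing R] (β : R) (b : ℕ → R)

/-- The sum over the possible lengths of one row in the branching rule, in terms of exponents of
factorial powers. -/
def branchRow (y x : R) (p q : ℕ) : R :=
  ∑ k ∈ Finset.Ico p q, (∏ l ∈ Finset.Ico (k + 1) q, (y + b l + β * y * b l)) *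
    (if p < k then 1 + β * (y + b k + β * y * b k) else 1) * shiftedPow β b x k

/-- The sum telescopes because (x − y)(1 + β(y⊕b)) = (1 + βy)((x⊕b) − (y⊕b)). The lowest term, which
lacks the factor 1 + β(y⊕b), uses (1 + βy)(x⊕b) − (1 + βx)(y⊕b) = x − y instead. -/
theorem sub_mul_branchRow (y x : R) {p q : ℕ} (h : p < q) :
    (x - y) * branchRow β b y x p q = (1 + β * y) * shiftedPow β b x q -
      (1 + β * x) * (∏ l ∈ Finset.Ico p q, (y + b l + β * y * b l)) * shiftedPow β b x p := by
  induction q, Nat.succ_le_of_lt h using Nat.le_induction with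
  | base =>
    simp only [branchRow, Nat.succ_eq_add_one, Finset.prod_Ico_eq_prod_range, shiftedPow,
      Nat.Ico_succ_singleton, Finset.sum_singleton, Finset.prod_range_succ]
    simp
    ring
  | succ q hq ih =>
    have hpq : p < q := hq
    have ih := ih hpq
    have h1 : branchRow β b y x p (q + 1) =
        (y + b q + β * y * b q) * branchRow β b y x p q +
          (1 + β * (y + b q + β * y * b q)) * shiftedPow β b x q := by
      rw [branchRow, Finset.sum_Ico_succ_top hpq.le, if_pos hpq, branchRow, Finset.mul_sum]
      congr 1
      · refine Finset.sum_congr rfl fun k hk => ?_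
        rw [Finset.prod_Ico_succ_top (Finset.mem_Ico.1 hk).2]
        ring
      · simp
    have h2 : shiftedPow β b x (q + 1) = shiftedPow β b x q * (x + b q + β * x * b q) :=
      Finset.prod_range_succ _ _
    rw [h1, h2, Finset.prod_Ico_succ_top hpq.le]
    linear_combination (y + b q + β * y * b q) * ih

/-- The numerator matrix of the determinantal formula, with exponents `q`. -/
def grothMatrix {n : ℕ} (x : Fin n → R) (q : Fin n → ℕ) : Matrix (Fin n) (Fin n) R :=
  Matrix.of fun i j => shiftedPow β b (x j) (q i) * (1 + β * x j) ^ (i : ℕ)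

/-- With y the last variable, replace each row i but the last by (1 + βy)·row i − Y_i·row (i+1), an
upper triangular operation `E` of determinant (1 + βy)^n. By `sub_mul_branchRow` the new entries
carry the factor x_j − y, so the column of y keeps only its last entry, which supplies the power on
the right. -/
theorem pow_mul_det_grothMatrix {n : ℕ} (x : Fin (n + 1) → R) {q : Fin (n + 1) → ℕ}
    (hq : StrictAnti q) :
    (1 + β * x (Fin.last n)) ^ n * (grothMatrix β b x q).det =
      (1 + β * x (Fin.last n)) ^ n * (shiftedPow β b (x (Fin.last n)) (q (Fin.last n)) *
        ((∏ j : Fin n, (x j.castSucc - x (Fin.last n))) *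
          (Matrix.of fun i j : Fin n => branchRow β b (x (Fin.last n)) (x j.castSucc) (q i.succ)
            (q i.castSucc) * (1 + β * x j.castSucc) ^ (i : ℕ)).det)) := by
  set y := x (Fin.last n) with hy
  set Y : Fin n → R := fun i =>
    ∏ l ∈ Finset.Ico (q i.succ) (q i.castSucc), (y + b l + β * y * b l) with hY
  have hlt : ∀ i : Fin n, q i.succ < q i.castSucc := fun i => hq Fin.castSucc_lt_succ
  let E : Matrix (Fin (n + 1)) (Fin (n + 1)) R :=
    Matrix.of (Fin.lastCases (Pi.single (Fin.last n) 1)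
      fun i : Fin n => (1 + β * y) • Pi.single i.castSucc 1 - Y i • Pi.single i.succ 1)
  have hElast : ∀ k, E (Fin.last n) k = if k = Fin.last n then 1 else 0 := fun k => by
    simp [E, Pi.single_apply]
  have hEcast : ∀ (i : Fin n) k, E i.castSucc k =
      (1 + β * y) * (if k = i.castSucc then 1 else 0) - Y i * if k = i.succ then 1 else 0 :=
    fun i k => by simp [E, Pi.single_apply]
  have hEdet : E.det = (1 + β * y) ^ n := by
    rw [Matrix.det_of_isUpperTriangular, Fin.prod_univ_castSucc]
    · simp [hElast, hEcast, (Fin.castSucc_lt_succ).ne]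
    · intro i j hij
      replace hij : j < i := hij
      induction i using Fin.lastCases with
      | last => rw [hElast, if_neg hij.ne]
      | cast i =>
        have h1 : j < i.castSucc := hij
        rw [hEcast, if_neg h1.ne, if_neg (h1.trans Fin.castSucc_lt_succ).ne]
        simp
  have hmul_last : ∀ j, (E * grothMatrix β b x q) (Fin.last n) j =
      shiftedPow β b (x j) (q (Fin.last n)) * (1 + β * x j) ^ n := by
    intro j
    simp [Matrix.mul_apply, hElast, grothMatrix]
  have hmul_cast : ∀ (i : Fin n) j, (E * grothMatrix β b x q) i.castSucc j =
      (x j - y) * (branchRow β b y (x j) (q i.succ) (q i.castSucc) *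
        (1 + β * x j) ^ (i : ℕ)) := by
    intro i j
    have : (E * grothMatrix β b x q) i.castSucc j =
        (1 + β * y) * (shiftedPow β b (x j) (q i.castSucc) * (1 + β * x j) ^ (i : ℕ)) -
          Y i * (shiftedPow β b (x j) (q i.succ) * (1 + β * x j) ^ ((i : ℕ) + 1)) := by
      simp [Matrix.mul_apply, hEcast, grothMatrix, sub_mul, Finset.sum_sub_distrib]
    rw [this]
    linear_combination -(1 + β * x j) ^ (i : ℕ) * sub_mul_branchRow β b y (x j) (hlt i)
  rw [← hEdet, ← Matrix.det_mul, Matrix.det_succ_column _ (Fin.last n), Fin.sum_univ_castSucc,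
    Finset.sum_eq_zero, zero_add, hmul_last, ← hy, hEdet]
  · have : (E * grothMatrix β b x q).submatrix (Fin.last n).succAbove (Fin.last n).succAbove =
        Matrix.of fun i j : Fin n => (x j.castSucc - y) *
          (Matrix.of fun i j : Fin n => branchRow β b y (x j.castSucc) (q i.succ)
            (q i.castSucc) * (1 + β * x j.castSucc) ^ (i : ℕ)) i j := by
      ext i j
      simp [hmul_cast]
    rw [this, Matrix.det_mul_row]
    simp only [Fin.val_last, ← two_mul, pow_mul]
    ring
  · intro i _
    rw [hmul_cast]
    simp [← hy]

end CommRing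

theorem map_shiftedPow {R S : Type*} [CommRing R] [CommRing S] (f : R →+* S) (β : R) (b : ℕ → R)
    (x : R) (p : ℕ) : f (shiftedPow β b x p) = shiftedPow (f β) (fun i => f (b i)) (f x) p := by
  simp [shiftedPow, map_prod]

theorem map_branchRow {R S : Type*} [CommRing R] [CommRing S] (f : R →+* S) (β : R) (b : ℕ → R)
    (y x : R) (p q : ℕ) :
    f (branchRow β b y x p q) = branchRow (f β) (fun i => f (b i)) (f y) (f x) p q := by
  simp [branchRow, map_sum, map_prod, map_shiftedPow, apply_ite f]

/-- The determinantal counterpart of the branching rule. The case `1 + β x_n = 0` is reached by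
letting `x_n` be an indeterminate. -/
theorem det_grothMatrix_succ {R : Type*} [CommRing R] [IsDomain R] (β : R) (b : ℕ → R) {n : ℕ}
    (x : Fin (n + 1) → R) {q : Fin (n + 1) → ℕ} (hq : StrictAnti q) :
    (grothMatrix β b x q).det =
      shiftedPow β b (x (Fin.last n)) (q (Fin.last n)) *
        ((∏ j : Fin n, (x j.castSucc - x (Fin.last n))) *
          (Matrix.of fun i j : Fin n => branchRow β b (x (Fin.last n)) (x j.castSucc) (q i.succ)
            (q i.castSucc) * (1 + β * x j.castSucc) ^ (i : ℕ)).det) := by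
  open Polynomial in
  let X' : Fin (n + 1) → R[X] := Fin.snoc (fun j : Fin n => C (x j.castSucc)) X
  have h := pow_mul_det_grothMatrix (C β) (fun i => C (b i)) X' hq
  -- 1 + βX takes the value 1 at 0, so it can be cancelled in the domain R[X] whatever β is.
  have hne : (1 + C β * X' (Fin.last n)) ^ n ≠ 0 := by
    refine pow_ne_zero _ fun h0 => ?_
    simpa [X'] using congrArg (eval 0) h0
  obtain ⟨φ, hφX, hφC⟩ : ∃ φ : R[X] →+* R, φ X = x (Fin.last n) ∧ ∀ a, φ (C a) = a :=
    ⟨evalRingHom (x (Fin.last n)), by simp, by simp⟩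
  have h' := congrArg φ (mul_left_cancel₀ hne h)
  have hX : ∀ j, φ (X' j) = x j := by
    intro j
    induction j using Fin.lastCases with
    | last => simp [X', hφX]
    | cast j => simp [X', hφC]
  simp only [RingHom.map_det, map_mul, map_prod, map_sub, map_shiftedPow, hX, hφC] at h'
  convert h' using 3
  · ext i j
    simp [grothMatrix, map_shiftedPow, hX, hφC]
  · congr 1
    ext i j
    simp [map_branchRow, hX, hφC]

/-! ### Vandermonde products -/

/-- The Vandermonde product `∏_{i<j} (x_i - x_j)`. -/
def vandermondeProd {R : Type*} [CommRing R] {n : ℕ} (x : Fin n → R) : R :=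
  ∏ i, ∏ j, if i < j then x i - x j else 1

section Vandermonde
variable {R : Type*} [CommRing R] {n : ℕ}

theorem vandermondeProd_castSucc (x : Fin (n + 1) → R) :
    vandermondeProd x =
      vandermondeProd (fun i => x i.castSucc) * ∏ j : Fin n, (x j.castSucc - x (Fin.last n)) := by
  rw [vandermondeProd, Fin.prod_univ_castSucc, vandermondeProd, ← Finset.prod_mul_distrib,
    Finset.prod_eq_one (fun j _ => if_neg (not_lt.2 (Fin.le_last j))), mul_one]
  refine Finset.prod_congr rfl fun i _ => ?_
  rw [Fin.prod_univ_castSucc, if_pos (Fin.castSucc_lt_last i)]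
  simp

theorem vandermondeProd_succ (x : Fin (n + 1) → R) :
    vandermondeProd x = (∏ j : Fin n, (x 0 - x j.succ)) * vandermondeProd (fun i => x i.succ) := by
  rw [vandermondeProd, Fin.prod_univ_succ, vandermondeProd]
  congr 1
  · simp [Fin.prod_univ_succ]
  · refine Finset.prod_congr rfl fun i _ => ?_
    simp [Fin.prod_univ_succ]

theorem det_vandermonde_eq (x : Fin n → R) :
    (Matrix.vandermonde x).det = ∏ i, ∏ j, if i < j then x j - x i else 1 := by
  rw [Matrix.det_vandermonde]
  refine Finset.prod_congr rfl fun i _ => ?_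
  rw [← Finset.prod_filter, Finset.filter_lt_eq_Ioi]

theorem vandermondeProd_ne_zero [IsDomain R] {x : Fin n → R} (hx : Function.Injective x) :
    vandermondeProd x ≠ 0 := by
  refine Finset.prod_ne_zero_iff.2 fun i _ => Finset.prod_ne_zero_iff.2 fun j _ => ?_
  split_ifs with h
  · exact sub_ne_zero.2 fun h' => h.ne (hx h')
  · exact one_ne_zero

theorem vandermondeProd_comp_rev (x : Fin n → R) :
    vandermondeProd (fun i => x i.rev) = (Matrix.vandermonde x).det := by
  rw [det_vandermonde_eq, vandermondeProd, Finset.prod_comm,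
    ← Equiv.prod_comp Fin.revPerm (fun i => ∏ j, if i < j then x j - x i else 1)]
  refine Finset.prod_congr rfl fun i _ => ?_
  rw [← Equiv.prod_comp Fin.revPerm (fun j => if Fin.revPerm i < j then x j - x _ else 1)]
  simp [Fin.rev_lt_rev]

/-- After reversal this permutes the rows of a Vandermonde matrix; conjugating σ by the reversal
keeps its sign. -/
theorem vandermondeProd_comp_perm (x : Fin n → R) (σ : Equiv.Perm (Fin n)) :
    vandermondeProd (fun i => x (σ i)) = ((Equiv.Perm.sign σ : ℤ) : R) * vandermondeProd x := by
  have h1 : ∀ y : Fin n → R, vandermondeProd y = (Matrix.vandermonde fun i => y i.rev).det := by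
    intro y
    rw [← vandermondeProd_comp_rev]
    simp
  have h2 : (Matrix.vandermonde fun i => x (σ i.rev)) =
      (Matrix.vandermonde fun i : Fin n => x i.rev).submatrix
        (Fin.revPerm.trans (σ.trans Fin.revPerm)) id := by
    ext i j
    simp [Matrix.vandermonde_apply]
  have h3 : Equiv.Perm.sign (Fin.revPerm.trans (σ.trans Fin.revPerm) : Equiv.Perm (Fin n)) =
      Equiv.Perm.sign σ := by
    rw [Equiv.Perm.sign_trans, Equiv.Perm.sign_trans]
    rcases Int.units_eq_one_or (Equiv.Perm.sign (Fin.revPerm (n := n))) with h | h <;> simp [h]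
  rw [h1, h1 x, h2, Matrix.det_permute, h3]

end Vandermonde

/-! ### The determinantal formula -/

/-- Multilinear expansion of a determinant whose rows are linear combinations. -/
theorem det_sum_mul {R : Type*} [CommRing R] {n : ℕ} (s : Fin n → Finset ℕ)
    (w : Fin n → ℕ → R) (f : Fin n → ℕ → Fin n → R) :
    (Matrix.of fun i j => ∑ a ∈ s i, w i a * f i a j).det =
      ∑ α ∈ Fintype.piFinset s,
        (∏ i, w i (α i)) * (Matrix.of fun i j => f i (α i) j).det := by
  have h := (Matrix.detRowAlternating (R := R) (n := Fin n)).toMultilinearMap.map_sum_finset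
    (fun i a => fun j => w i a * f i a j) s
  have h1 : (Matrix.of fun i j => ∑ a ∈ s i, w i a * f i a j) =
      fun i => ∑ a ∈ s i, fun j => w i a * f i a j := by
    ext i j
    simp
  rw [h1]
  refine h.trans (Finset.sum_congr rfl fun α _ => ?_)
  exact Matrix.det_mul_column (fun i => w i (α i)) (Matrix.of fun i j => f i (α i) j)

theorem facGroth_empty {K : Type*} [Field K] {n : ℕ} (β : K) (x : Fin n → K) (t : ℤ → K) :
    facGroth β x t ∅ = 1 := by
  have h : ∀ T : ((∅ : Finset (ℕ × ℕ)) → Finset (Fin n)), IsSetValuedTableau ∅ T := fun T =>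
    ⟨fun c => absurd c.2 (Finset.notMem_empty _), fun c => absurd c.2 (Finset.notMem_empty _),
      fun c => absurd c.2 (Finset.notMem_empty _)⟩
  rw [facGroth, Finset.filter_true_of_mem fun T _ => h T]
  simp

/-- Substitute k = m + d, which passes from row lengths to exponents; d is the staircase shift in
the smaller alphabet and d + 1 the one in the larger. -/
theorem sum_branch_eq_branchRow {R : Type*} [CommRing R] (β : R) (b : ℕ → R) (y x : R)
    (l₁ l₂ d : ℕ) :
    ∑ m ∈ Finset.Icc l₁ l₂, ((∏ j ∈ Finset.Ico m l₂,
        (y + b (j + (d + 1)) + β * y * b (j + (d + 1)))) *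
      (if l₁ < m then 1 + β * (y + b (m + d) + β * y * b (m + d)) else 1)) *
        shiftedPow β b x (m + d) = branchRow β b y x (l₁ + d) (l₂ + (d + 1)) := by
  rw [branchRow, ← add_assoc, add_right_comm, ← Finset.sum_Ico_add', Finset.Ico_add_one_right_eq_Icc]
  refine Finset.sum_congr rfl fun m _ => ?_
  rw [Finset.prod_Ico_add' (fun l => y + b l + β * y * b l)]
  simp only [add_lt_add_iff_right, add_assoc, add_comm d 1]

/-- The determinantal formula for factorial Grothendieck polynomials. -/
theorem facGroth_rowCells_mul_vandermondeProd {K : Type*} [Field K] (β : K) (t : ℤ → K) {n : ℕ}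
    (x : Fin n → K) {lam : Fin n → ℕ} (hlam : Antitone lam) :
    facGroth β x t (rowCells lam) * vandermondeProd x =
      (grothMatrix β (fun i => t ((i : ℤ) + 1)) x fun i => lam i + (n - 1 - (i : ℕ))).det := by
  induction n with
  | zero =>
    have : rowCells lam = ∅ := by simp [rowCells]
    rw [this, facGroth_empty]
    simp [vandermondeProd]
  | succ n ih =>
    set b : ℕ → K := fun i => t ((i : ℤ) + 1) with hb
    set y := x (Fin.last n) with hy
    have hq : StrictAnti fun i : Fin (n + 1) => lam i + (n + 1 - 1 - (i : ℕ)) := by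
      intro i j hij
      have h1 := hlam hij.le
      have h2 : (i : ℕ) < j := hij
      have h3 := j.2
      simp only
      omega
    have hu : ∀ l : ℕ, ∀ z : ℤ, z = (l : ℤ) + 1 → fglAdd β y (t z) = y + b l + β * y * b l :=
      fun l z hz => by rw [hz, fglAdd]
    rw [facGroth_rowCells_succ β x t hlam _ fun c => rfl, vandermondeProd_castSucc,
      det_grothMatrix_succ β b x hq, ← hy]
    -- Each row becomes a sum over the admissible lengths of that row, so multilinearity yields a
    -- sum over `interlacing lam`.
    have h1 : (Matrix.of fun i j : Fin n => branchRow β b y (x j.castSucc)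
          (lam i.succ + (n + 1 - 1 - (i.succ : ℕ))) (lam i.castSucc + (n + 1 - 1 - (i.castSucc : ℕ)))
          * (1 + β * x j.castSucc) ^ (i : ℕ)) =
        Matrix.of fun i j : Fin n => ∑ m ∈ Finset.Icc (lam i.succ) (lam i.castSucc),
          ((∏ k ∈ Finset.Ico m (lam i.castSucc),
              fglAdd β y (t ((n : ℤ) + 1 + (k : ℤ) - ((i : ℕ) : ℤ)))) *
            if lam i.succ < m then
              1 + β * fglAdd β y (t ((n : ℤ) + 1 + ((m - 1 : ℕ) : ℤ) - ((i : ℕ) : ℤ)))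
            else 1) *
          (shiftedPow β b (x j.castSucc) (m + (n - 1 - (i : ℕ))) *
            (1 + β * x j.castSucc) ^ (i : ℕ)) := by
      ext i j
      have hi := i.2
      have e1 : n + 1 - 1 - (i.succ : ℕ) = n - 1 - (i : ℕ) := by rw [Fin.val_succ]; omega
      have e2 : n + 1 - 1 - (i.castSucc : ℕ) = n - 1 - (i : ℕ) + 1 := by
        rw [Fin.val_castSucc]; omega
      rw [Matrix.of_apply, Matrix.of_apply, e1, e2, ← sum_branch_eq_branchRow, Finset.sum_mul]
      refine Finset.sum_congr rfl fun m hm => ?_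
      rw [← mul_assoc]
      congr 3
      · exact Finset.prod_congr rfl fun k _ => (hu _ _ (by push_cast; omega)).symm
      -- Here `h` makes m positive, so `m - 1` is a true predecessor.
      · split_ifs with h
        · rw [hu (m + (n - 1 - (i : ℕ))) _ (by push_cast; omega)]
        · rfl
    have h2 : shiftedPow β b y (lam (Fin.last n) + (n + 1 - 1 - (Fin.last n : ℕ))) =
        ∏ k ∈ Finset.range (lam (Fin.last n)), fglAdd β y (t ((n : ℤ) + 1 + (k : ℤ) - (n : ℤ))) := by
      rw [Fin.val_last, Nat.add_sub_cancel, Nat.sub_self, add_zero, shiftedPow]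
      exact Finset.prod_congr rfl fun k _ => (hu _ _ (by ring)).symm
    rw [h1, h2, det_sum_mul (fun i : Fin n => Finset.Icc (lam i.succ) (lam i.castSucc)), mul_assoc]
    congr 1
    rw [mul_comm (vandermondeProd _), ← mul_assoc, mul_comm (Finset.sum _ _), mul_assoc,
      Finset.sum_mul]
    congr 1
    refine Finset.sum_congr rfl fun m hm => ?_
    rw [mul_assoc, ih _ (antitone_of_mem_interlacing hlam hm)]
    rfl

/-! ### Complete homogeneous polynomials and the coefficients Γ -/

/-- The complete homogeneous polynomial of degree `i` in `g 0, …, g (s - 1)`. -/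
def completeHom {R : Type*} [CommRing R] (g : ℕ → R) : ℕ → ℕ → R
  | _, 0 => 1
  | 0, _ + 1 => 0
  | s + 1, i + 1 => g s * completeHom g (s + 1) i + completeHom g s (i + 1)
termination_by s i => (i, s)

section CompleteHom
variable {R : Type*} [CommRing R]

@[simp] theorem completeHom_zero_right (g : ℕ → R) (s : ℕ) : completeHom g s 0 = 1 := by
  cases s <;> simp [completeHom]

@[simp] theorem completeHom_zero_succ (g : ℕ → R) (i : ℕ) : completeHom g 0 (i + 1) = 0 := by
  simp [completeHom]

theorem completeHom_succ_succ (g : ℕ → R) (s i : ℕ) :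
    completeHom g (s + 1) (i + 1) =
      g s * completeHom g (s + 1) i + completeHom g s (i + 1) := by
  rw [completeHom]

/-- The sum of `∏ f (J l)` over the weakly increasing sequences `J` of length `i` in `[lo, hi)`. -/
def monotoneSum (f : ℕ → R) (i lo hi : ℕ) : R :=
  ∑ J ∈ (Fintype.piFinset (fun _ : Fin i => Finset.Ico lo hi)).filter
      (fun J => ∀ k l : Fin i, k ≤ l → J k ≤ J l), ∏ l, f (J l)

theorem monotoneSum_zero (f : ℕ → R) (lo hi : ℕ) : monotoneSum f 0 lo hi = 1 := by
  simp [monotoneSum]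

/-- Split off the smallest entry j; the others form a weakly increasing sequence in [j, hi). -/
theorem monotoneSum_succ (f : ℕ → R) (i lo hi : ℕ) :
    monotoneSum f (i + 1) lo hi = ∑ j ∈ Finset.Ico lo hi, f j * monotoneSum f i j hi := by
  simp only [monotoneSum, Finset.mul_sum]
  rw [Finset.sum_sigma']
  refine Finset.sum_bij' (fun J _ => ⟨J 0, Fin.tail J⟩) (fun p _ => Fin.cons p.1 p.2) ?_ ?_ ?_ ?_ ?_
  · intro J hJ
    simp only [Finset.mem_filter, Fintype.mem_piFinset, Finset.mem_Ico, Finset.mem_sigma,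
      Fin.tail] at hJ ⊢
    exact ⟨hJ.1 0, fun l => ⟨hJ.2 _ _ (Fin.zero_le _), (hJ.1 _).2⟩,
      fun k l h => hJ.2 _ _ (Fin.succ_le_succ_iff.2 h)⟩
  · rintro ⟨j, J⟩ hJ
    simp only [Finset.mem_filter, Fintype.mem_piFinset, Finset.mem_Ico, Finset.mem_sigma] at hJ ⊢
    obtain ⟨h1, h2, h3⟩ := hJ
    refine ⟨fun l => ?_, fun k l h => ?_⟩
    · induction l using Fin.cases with
      | zero => exact h1
      | succ l => exact ⟨h1.1.trans (h2 l).1, (h2 l).2⟩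
    · induction k using Fin.cases with
      | zero =>
        induction l using Fin.cases with
        | zero => exact le_rfl
        | succ l => exact (h2 l).1
      | succ k =>
        induction l using Fin.cases with
        | zero => exact absurd h (not_le.2 (Fin.succ_pos k))
        | succ l => exact h3 _ _ (Fin.succ_le_succ_iff.1 h)
  · intro J _
    exact Fin.cons_self_tail J
  · intro p _
    simp
  · intro J _
    rw [Fin.prod_univ_succ]
    rfl

/-- Reversing the interval makes `lo` the last variable: either it is used once more or it is
dropped, which is the recursion of `completeHom`. -/
theorem monotoneSum_eq_completeHom (f g : ℕ → R) (i : ℕ) {lo hi : ℕ} (h : lo ≤ hi)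
    (hfg : ∀ j < hi, f j = g (hi - 1 - j)) :
    monotoneSum f i lo hi = completeHom g (hi - lo) i := by
  induction i generalizing lo with
  | zero => rw [monotoneSum_zero, completeHom_zero_right]
  | succ i ih =>
    rw [monotoneSum_succ]
    obtain ⟨d, rfl⟩ := Nat.exists_eq_add_of_le h
    rw [Nat.add_sub_cancel_left]
    induction d generalizing lo with
    | zero => simp
    | succ d ihd =>
      have e : lo + (d + 1) = lo + 1 + d := by ring
      rw [Finset.sum_eq_sum_Ico_succ_bot (by omega), ih (by omega), hfg lo (by omega),
        completeHom_succ_succ]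
      congr 1
      · congr 2 <;> omega
      · have := ihd (lo := lo + 1)
        rw [← e] at this
        exact this hfg ih (by omega)

/-- Iterating `c Y_a = g_a (Y_a + β Y_{a+1})`. -/
theorem pow_mul_eq_sum_completeHom (β c : R) (g Y : ℕ → R)
    (h : ∀ a, c * Y a = g a * (Y a + β * Y (a + 1))) (r : ℕ) :
    c ^ r * Y 0 = ∑ a ∈ Finset.range (r + 1),
      β ^ a * ((∏ l ∈ Finset.range a, g l) * completeHom g (a + 1) (r - a)) * Y a := by
  induction r with
  | zero => simp
  | succ r ih =>
    -- Split by whether g_a occurs. The part with g_a comes from the Y_a term of `h`, the part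
    -- without it from the Y_{a+1} term one index lower.
    have h1 : ∀ a ∈ Finset.range (r + 1),
        β ^ a * ((∏ l ∈ Finset.range a, g l) * completeHom g (a + 1) (r + 1 - a)) * Y a =
        β ^ a * ((∏ l ∈ Finset.range a, g l) * (g a * completeHom g (a + 1) (r - a))) * Y a +
          β ^ a * ((∏ l ∈ Finset.range a, g l) * completeHom g a (r + 1 - a)) * Y a := by
      intro a ha
      have : r + 1 - a = r - a + 1 := by rw [Finset.mem_range] at ha; omega
      rw [this, completeHom_succ_succ]
      ring
    have h2 : (∑ a ∈ Finset.range (r + 1),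
          β ^ a * ((∏ l ∈ Finset.range a, g l) * completeHom g a (r + 1 - a)) * Y a) +
        β ^ (r + 1) * ((∏ l ∈ Finset.range (r + 1), g l) *
          completeHom g (r + 1 + 1) (r + 1 - (r + 1))) * Y (r + 1) =
        ∑ a ∈ Finset.range (r + 1), β ^ (a + 1) * ((∏ l ∈ Finset.range (a + 1), g l) *
          completeHom g (a + 1) (r - a)) * Y (a + 1) := by
      have := Finset.sum_range_succ (fun a =>
        β ^ a * ((∏ l ∈ Finset.range a, g l) * completeHom g a (r + 1 - a)) * Y a) (r + 1)
      rw [Finset.sum_range_succ'] at this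
      simp only [Nat.sub_zero, completeHom_zero_succ, mul_zero, zero_mul, add_zero, Nat.sub_self,
        completeHom_zero_right, Nat.add_sub_add_right] at this ⊢
      exact this.symm
    rw [Finset.sum_range_succ, Finset.sum_congr rfl h1, Finset.sum_add_distrib, add_assoc, h2,
      pow_succ', mul_assoc, ih, Finset.mul_sum, ← Finset.sum_add_distrib]
    refine Finset.sum_congr rfl fun a _ => ?_
    rw [Finset.prod_range_succ]
    linear_combination β ^ a * ((∏ l ∈ Finset.range a, g l) * completeHom g (a + 1) (r - a)) * h a

end CompleteHom

/-- The substitution l = r − 1 − j reverses the indices, and the interval of summation has a + 1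
elements. -/
theorem gammaReduced_eq_completeHom {K : Type*} [Field K] (β : K) (t : ℤ → K) {a r k : ℕ}
    (h : a ≤ r) (m : ℤ) (hm : m = (k : ℤ) + r) :
    gammaReduced β t (r - a) r m =
      (∏ l ∈ Finset.range a, (1 + β * t (((k + l : ℕ) : ℤ) + 1))) *
        completeHom (fun l => 1 + β * t (((k + l : ℕ) : ℤ) + 1)) (a + 1) (r - a) := by
  rw [gammaReduced]
  congr 1
  · rw [Finset.prod_Ico_eq_prod_range, Nat.sub_sub_self h, ← Finset.prod_range_reflect]
    refine Finset.prod_congr rfl fun l hl => ?_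
    rw [Finset.mem_range] at hl
    congr 3
    omega
  · change monotoneSum (fun j => 1 + β * t (m - (j : ℤ))) _ _ _ = _
    rw [monotoneSum_eq_completeHom _ (fun l => 1 + β * t (((k + l : ℕ) : ℤ) + 1)) _ (by omega)]
    -- For a = r the lower bound `r - a - 1` is truncated and the interval has only r elements; in
    -- degree 0 this does not matter.
    · rcases (Nat.eq_zero_or_pos (r - a)) with h0 | h0
      · rw [h0, completeHom_zero_right, completeHom_zero_right]
      · congr 1
        omega
    · intro j hj
      congr 3
      omega

section fglNeg
variable {K : Type*} [Field K] {β : K} {t : ℤ → K}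

theorem fglAdd_fglNeg (ht : ∀ j : ℤ, 1 + β * t j ≠ 0) (x : K) (j : ℤ) :
    fglAdd β x (fglNeg β t j) = (x - t j) / (1 + β * t j) := by
  have h : (0 - t j) / (1 + β * t j) * (1 + β * t j) = 0 - t j := div_mul_cancel₀ _ (ht j)
  rw [fglAdd, fglNeg, fglSub, eq_div_iff (ht j)]
  linear_combination (1 + β * x) * h

/-- Since x ⊕ (⊖t) = (x − t)/(1 + βt), one has 1 + βx = (1 + βt)(1 + β(x ⊕ (⊖t))). -/
theorem one_add_mul_facPow (ht : ∀ j : ℤ, 1 + β * t j ≠ 0) (x : K) (p : ℕ) :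
    (1 + β * x) * facPow β (fglNeg β t) x p = (1 + β * t ((p : ℤ) + 1)) *
      (facPow β (fglNeg β t) x p + β * facPow β (fglNeg β t) x (p + 1)) := by
  have h := ht ((p : ℤ) + 1)
  have h1 : facPow β (fglNeg β t) x (p + 1) =
      facPow β (fglNeg β t) x p * ((x - t ((p : ℤ) + 1)) / (1 + β * t ((p : ℤ) + 1))) := by
    rw [facPow, Finset.prod_Icc_succ_top (by omega), fglAdd_fglNeg ht, facPow]
    push_cast
    rfl
  rw [h1]
  field_simp
  ring

/-- The expansion of `(1 + β x)^i (x|⊖t)^k` in factorial powers. -/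
theorem pow_mul_facPow_eq_sum (ht : ∀ j : ℤ, 1 + β * t j ≠ 0) (x : K) {n i : ℕ} (hi : i < n)
    (p : ℕ) :
    facPow β (fglNeg β t) x (p + (n - 1 - i)) * (1 + β * x) ^ i =
      ∑ a ∈ Finset.range (i + 1), β ^ a * varphiCoeff β t n i a p *
        facPow β (fglNeg β t) x (p + a + (n - 1 - i)) := by
  have h := pow_mul_eq_sum_completeHom β (1 + β * x)
    (fun l => 1 + β * t (((p + (n - 1 - i) + l : ℕ) : ℤ) + 1))
    (fun a => facPow β (fglNeg β t) x (p + (n - 1 - i) + a))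
    (fun a => one_add_mul_facPow ht x _) i
  rw [add_zero] at h
  rw [mul_comm, h]
  refine Finset.sum_congr rfl fun a ha => ?_
  rw [varphiCoeff, gammaReduced_eq_completeHom β t (k := p + (n - 1 - i))
    (Nat.lt_succ_iff.1 (Finset.mem_range.1 ha)) _ (by omega), add_right_comm p a]

end fglNeg

/-! ### Determinants of initial factorial powers and the expansion of G_λ -/

theorem prod_prod_range {M : Type*} [CommMonoid M] (g : ℕ → M) (n : ℕ) :
    ∏ i : Fin n, ∏ l ∈ Finset.range (i : ℕ), g l = ∏ l : Fin n, g l ^ (n - 1 - (l : ℕ)) := by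
  induction n with
  | zero => simp
  | succ n ih =>
    rw [Fin.prod_univ_castSucc, Fin.prod_univ_castSucc]
    simp only [Fin.val_castSucc, Fin.val_last, ih, Nat.add_sub_cancel, Nat.sub_self, pow_zero,
      mul_one]
    rw [← Fin.prod_univ_eq_prod_range, ← Finset.prod_mul_distrib]
    refine Finset.prod_congr rfl fun i _ => ?_
    rw [← pow_succ]
    congr 1
    omega

/-- Column j evaluates a monic polynomial of degree j. -/
theorem det_prod_sub_eq_det_vandermonde {R : Type*} [CommRing R] [Nontrivial R] {n : ℕ}
    (y : Fin n → R) (s : ℕ → R) :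
    (Matrix.of fun i j : Fin n => ∏ l ∈ Finset.range (j : ℕ), (y i - s l)).det =
      (Matrix.vandermonde y).det := by
  open Polynomial in
  rw [Matrix.det_eval_matrixOfPolynomials_eq_det_vandermonde y
    (fun j : Fin n => ∏ l ∈ Finset.range (j : ℕ), (X - C (s l)))]
  · congr 1
    ext i j
    simp [eval_prod]
  · intro i
    rw [natDegree_prod_of_monic _ _ fun l _ => monic_X_sub_C _]
    simp
  · exact fun i => monic_prod_of_monic _ _ fun l _ => monic_X_sub_C _

section fglNeg
variable {K : Type*} [Field K] {β : K} {t : ℤ → K}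

/-- Determinants of initial factorial powers are Vandermonde determinants up to a factor. -/
theorem det_prod_fglAdd_fglNeg (ht : ∀ j : ℤ, 1 + β * t j ≠ 0) {n : ℕ} (y : Fin n → K)
    (s : ℕ → ℤ) :
    (Matrix.of fun i j : Fin n =>
        ∏ l ∈ Finset.range (j : ℕ), fglAdd β (y i) (fglNeg β t (s l))).det *
      ∏ l : Fin n, (1 + β * t (s l)) ^ (n - 1 - (l : ℕ)) = (Matrix.vandermonde y).det := by
  rw [← prod_prod_range (fun l => 1 + β * t (s l)), mul_comm, ← Matrix.det_mul_row,
    ← det_prod_sub_eq_det_vandermonde y (fun l => t (s l))]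
  congr 1
  ext i j
  simp only [Matrix.of_apply, ← Finset.prod_mul_distrib]
  refine Finset.prod_congr rfl fun l _ => ?_
  rw [fglAdd_fglNeg ht, mul_div_cancel₀ _ (ht _)]

theorem facPow_eq_prod_range (t : ℤ → K) (u : K) (r : ℕ) :
    facPow β t u r = ∏ l ∈ Finset.range r, fglAdd β u (t ((l : ℤ) + 1)) :=
  facPow_eq_shiftedPow β t u r

/-- Transposing and reversing both indices turns the exponents n − i into 0, 1, …, n − 1. The
product on the left is also the denominator of φ_α. -/
theorem facPowDet_zero_mul (ht : ∀ j : ℤ, 1 + β * t j ≠ 0) {n : ℕ} (x : Fin n → K) :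
    facPowDet β x (fglNeg β t) (fun _ => 0) *
      ∏ i : Fin n, (1 + β * t (((i : ℕ) : ℤ) + 1)) ^ (n - 1 - (i : ℕ)) = vandermondeProd x := by
  have h := det_prod_fglAdd_fglNeg ht (fun i => x i.rev) (fun l => (l : ℤ) + 1)
  rw [← vandermondeProd_comp_rev] at h
  simp only [Fin.rev_rev] at h
  rw [← h, facPowDet, ← Matrix.det_transpose, ← Matrix.det_submatrix_equiv_self Fin.revPerm]
  congr 2
  ext i j
  simp only [Matrix.submatrix_apply, Matrix.transpose_apply, Matrix.of_apply,
    facPow_eq_prod_range, Fin.revPerm_apply, Fin.val_rev]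
  congr 2
  have := j.2
  omega

theorem facPowDet_zero_ne_zero (ht : ∀ j : ℤ, 1 + β * t j ≠ 0) {n : ℕ} {x : Fin n → K}
    (hx : Function.Injective x) : facPowDet β x (fglNeg β t) (fun _ => 0) ≠ 0 :=
  left_ne_zero_of_mul (facPowDet_zero_mul ht x ▸ vandermondeProd_ne_zero hx)

theorem prod_pow_ne_zero (ht : ∀ j : ℤ, 1 + β * t j ≠ 0) {n : ℕ} (s : Fin n → ℤ) :
    ∏ i : Fin n, (1 + β * t (s i)) ^ (n - 1 - (i : ℕ)) ≠ 0 :=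
  Finset.prod_ne_zero_iff.2 fun _ _ => pow_ne_zero _ (ht _)

/-- The expansion of `G_λ(x|⊖t)` in the ratios `F_{λ+α}(x|⊖t)`. -/
theorem facGroth_rowCells_eq_sum (ht : ∀ j : ℤ, 1 + β * t j ≠ 0) {n : ℕ} {x : Fin n → K}
    (hx : Function.Injective x) {lam : Fin n → ℕ} (hlam : Antitone lam) :
    facGroth β x (fglNeg β t) (rowCells lam) =
      ∑ α ∈ Fintype.piFinset (fun i : Fin n => Finset.range ((i : ℕ) + 1)),
        β ^ (∑ i, α i) * phiCoeff β t α lam *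
          facF β x (fglNeg β t) (fun i => lam i + α i) := by
  have hV := facPowDet_zero_mul ht x
  have hD := facPowDet_zero_ne_zero ht hx
  have hP := prod_pow_ne_zero ht (fun i : Fin n => ((i : ℕ) : ℤ) + 1)
  have hdet : (grothMatrix β (fun i => fglNeg β t ((i : ℤ) + 1)) x
        fun i => lam i + (n - 1 - (i : ℕ))).det =
      ∑ α ∈ Fintype.piFinset (fun i : Fin n => Finset.range ((i : ℕ) + 1)),
        (∏ i : Fin n, β ^ α i * varphiCoeff β t n i (α i) (lam i)) *
          facPowDet β x (fglNeg β t) (fun i => lam i + α i) := by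
    have h := det_sum_mul (fun i : Fin n => Finset.range ((i : ℕ) + 1))
      (fun i a => β ^ a * varphiCoeff β t n i a (lam i))
      (fun i a j => facPow β (fglNeg β t) (x j) (lam i + a + (n - 1 - (i : ℕ))))
    refine Eq.trans ?_ h
    congr 1
    ext i j
    rw [Matrix.of_apply, ← pow_mul_facPow_eq_sum ht (x j) i.2, facPow_eq_shiftedPow]
    rfl
  rw [← facGroth_rowCells_mul_vandermondeProd β (fglNeg β t) x hlam, ← hV] at hdet
  rw [← mul_left_inj' (mul_ne_zero hD hP), hdet, Finset.sum_mul]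
  refine Finset.sum_congr rfl fun α hα => ?_
  -- In the first row α vanishes and the coefficient is 1.
  have hvar : ∏ i : Fin n, varphiCoeff β t n i (α i) (lam i) =
      ∏ i ∈ Finset.univ.filter (fun i : Fin n => 1 ≤ (i : ℕ)),
        varphiCoeff β t n (i : ℕ) (α i) (lam i) := by
    symm
    refine Finset.prod_filter_of_ne fun i _ hi => ?_
    by_contra h0
    have h0 : (i : ℕ) = 0 := by omega
    have h1 : α i = 0 := by
      have := Finset.mem_range.1 (Fintype.mem_piFinset.1 hα i)
      omega
    refine hi ?_
    rw [h1, h0]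
    simp [varphiCoeff, gammaReduced]
  rw [Finset.prod_mul_distrib, Finset.prod_pow_eq_pow_sum, hvar, phiCoeff, facF]
  field_simp

end fglNeg

/-! ### One-row polynomials and Jacobi–Trudy determinants -/

section Row
variable {K : Type*} [Field K]

theorem prod_erase_univ_succAbove {M : Type*} [CommMonoid M] {n : ℕ} (k : Fin (n + 1))
    (f : Fin (n + 1) → M) :
    ∏ j ∈ Finset.univ.erase k, f j = ∏ j : Fin n, f (k.succAbove j) := by
  have h : Finset.univ.erase k = Finset.univ.image k.succAbove := by
    ext
    simp
  rw [h, Finset.prod_image fun _ _ _ _ h => Fin.succAbove_right_injective h]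

/-- The cycle moving k to the front has sign (−1)^k. -/
theorem vandermondeProd_succAbove {R : Type*} [CommRing R] {n : ℕ} (x : Fin (n + 1) → R)
    (k : Fin (n + 1)) :
    vandermondeProd x = (-1) ^ (k : ℕ) * ((∏ j : Fin n, (x k - x (k.succAbove j))) *
      vandermondeProd fun j => x (k.succAbove j)) := by
  have h := vandermondeProd_comp_perm x k.cycleRange.symm
  rw [vandermondeProd_succ, Equiv.Perm.sign_symm, Fin.sign_cycleRange] at h
  simp only [Fin.cycleRange_symm_zero, Fin.cycleRange_symm_succ] at h
  rw [h, ← mul_assoc]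
  push_cast
  rw [← mul_pow]
  simp

/-- The one-row factorial Grothendieck polynomial as a symmetrised factorial power. -/
theorem facGroth_row_eq_sum (β : K) (t : ℤ → K) {n : ℕ} {x : Fin (n + 1) → K}
    (hx : Function.Injective x) (r : ℕ) :
    facGroth β x t (({0} : Finset ℕ) ×ˢ Finset.range r) =
      ∑ i, facPow β t (x i) (r + n) * ∏ j ∈ Finset.univ.erase i, (1 + β * x j) / (x i - x j) := by
  have hcells : ({0} : Finset ℕ) ×ˢ Finset.range r =
      rowCells (Fin.cons r fun _ => 0 : Fin (n + 1) → ℕ) := by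
    ext ⟨i, j⟩
    rw [mem_rowCells]
    simp only [Finset.mem_product, Finset.mem_singleton, Finset.mem_range]
    constructor
    · rintro ⟨rfl, h⟩
      exact ⟨Nat.succ_pos n, h⟩
    · rintro ⟨h, h'⟩
      cases i with
      | zero => exact ⟨rfl, h'⟩
      | succ i => exact absurd h' (Nat.not_lt_zero _)
  have hanti : Antitone (Fin.cons r fun _ => 0 : Fin (n + 1) → ℕ) := by
    intro i j hij
    induction j using Fin.cases with
    | zero => rw [Fin.le_zero_iff.1 hij]
    | succ j => exact Nat.zero_le _
  have hV := vandermondeProd_ne_zero hx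
  rw [hcells, ← mul_left_inj' hV, facGroth_rowCells_mul_vandermondeProd β t x hanti,
    Matrix.det_succ_row_zero, Finset.sum_mul]
  refine Finset.sum_congr rfl fun k _ => ?_
  -- The minor is the matrix of the empty shape in the other n variables, with an extra factor 1 +
  -- βx in each column; G_∅ = 1 evaluates it.
  have hminor : ((grothMatrix β (fun i => t ((i : ℤ) + 1)) x fun i =>
        (Fin.cons r fun _ => 0 : Fin (n + 1) → ℕ) i + (n + 1 - 1 - (i : ℕ))).submatrix
          Fin.succ k.succAbove).det =
      (∏ j : Fin n, (1 + β * x (k.succAbove j))) *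
        vandermondeProd fun j => x (k.succAbove j) := by
    have h0 := facGroth_rowCells_mul_vandermondeProd β t (fun j => x (k.succAbove j))
      (lam := fun _ => 0) (fun _ _ _ => le_rfl)
    have hempty : rowCells (fun _ : Fin n => 0) = ∅ := by simp [rowCells]
    rw [hempty, facGroth_empty, one_mul] at h0
    rw [h0, ← Matrix.det_mul_row]
    congr 1
    ext i j
    have e : n + 1 - 1 - (i.succ : ℕ) = n - 1 - (i : ℕ) := by
      rw [Fin.val_succ]
      omega
    simp only [grothMatrix, Matrix.submatrix_apply, Matrix.of_apply, Fin.cons_succ, e]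
    rw [Fin.val_succ, pow_succ]
    ring
  have hne : ∏ j : Fin n, (x k - x (k.succAbove j)) ≠ 0 :=
    Finset.prod_ne_zero_iff.2 fun j _ =>
      sub_ne_zero.2 fun h => Fin.succAbove_ne k j (hx h).symm
  rw [hminor, prod_erase_univ_succAbove, Finset.prod_div_distrib, vandermondeProd_succAbove x k,
    facPow_eq_shiftedPow]
  simp only [grothMatrix, Matrix.of_apply, Fin.cons_zero, Fin.val_zero, pow_zero, mul_one,
    Nat.sub_zero, Nat.add_sub_cancel]
  field_simp

/-- The convention for negative r continues the formula for r ≥ 0, so no case distinction is needed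
later. For n = 0 it fails at r = 0, where G_0 = 1 but the sum is empty. -/
theorem facGrothRow_eq_sum (β : K) (t : ℤ → K) {n : ℕ} {x : Fin n → K}
    (hx : Function.Injective x) (hn : 0 < n) (r : ℤ) :
    facGrothRow β x t r = ∑ i, facPow β t (x i) ((n : ℤ) + r - 1).toNat *
      ∏ j ∈ Finset.univ.erase i, (1 + β * x j) / (x i - x j) := by
  rw [facGrothRow]
  split_ifs with h
  · obtain ⟨n, rfl⟩ := Nat.exists_eq_succ_of_ne_zero hn.ne'
    rw [facGroth_row_eq_sum β t hx]
    have : (((n.succ : ℕ) : ℤ) + r - 1).toNat = r.toNat + n := by omega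
    rw [this]
  · rfl

/-- The first j factors have indices 1 − j, …, 0 and do not involve N; the remaining ones form the
unshifted power. -/
theorem facPow_shiftSeq (β : K) (t : ℤ → K) (u : K) (N j : ℕ) :
    facPow β (shiftSeq (-(j : ℤ)) t) u (N + j) =
      facPow β t u N * ∏ l ∈ Finset.range j, fglAdd β u (t (-(l : ℤ))) := by
  rw [facPow_eq_prod_range, facPow_eq_prod_range, add_comm, Finset.prod_range_add, mul_comm]
  congr 1
  · refine Finset.prod_congr rfl fun l _ => ?_
    rw [shiftSeq]
    congr 2
    push_cast
    ring
  · rw [← Finset.prod_range_reflect]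
    refine Finset.prod_congr rfl fun l hl => ?_
    rw [Finset.mem_range] at hl
    rw [shiftSeq]
    congr 2
    omega

theorem prod_prod_erase_sub {R : Type*} [CommRing R] {n : ℕ} (x : Fin n → R) :
    ∏ i, ∏ j ∈ Finset.univ.erase i, (x i - x j) =
      vandermondeProd x * (Matrix.vandermonde x).det := by
  rw [det_vandermonde_eq, vandermondeProd, Finset.prod_comm (s := Finset.univ) (t := Finset.univ)
    (f := fun i j => if i < j then x j - x i else 1), ← Finset.prod_mul_distrib]
  refine Finset.prod_congr rfl fun i _ => ?_
  rw [← Finset.prod_mul_distrib, ← Finset.mul_prod_erase _ _ (Finset.mem_univ i)]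
  simp only [lt_irrefl, if_false, one_mul]
  refine Finset.prod_congr rfl fun j hj => ?_
  rcases lt_or_gt_of_ne (Finset.ne_of_mem_erase hj) with h | h
  · simp [h, h.not_gt]
  · simp [h, h.not_gt]

theorem prod_prod_erase_const {M : Type*} [CommMonoid M] {n : ℕ} (f : Fin n → M) :
    ∏ i : Fin n, ∏ j ∈ Finset.univ.erase i, f j = (∏ i, f i) ^ (n - 1) := by
  rw [Finset.prod_comm' (t' := Finset.univ) (s' := fun j => Finset.univ.erase j)
    (by simp [ne_comm]), ← Finset.prod_pow]
  exact Finset.prod_congr rfl fun j _ => by simp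

/-- The Jacobi–Trudy formula for the ratios `F_μ(x|⊖t)`. -/
theorem pow_mul_facF_eq_det {β : K} {t : ℤ → K} (ht : ∀ j : ℤ, 1 + β * t j ≠ 0) {n : ℕ}
    {x : Fin n → K} (hx : Function.Injective x) (μ : Fin n → ℕ) :
    (∏ i, (1 + β * x i)) ^ (n - 1) * facF β x (fglNeg β t) μ =
      (∏ i : Fin n, ((1 + β * t (((i : ℕ) : ℤ) + 1)) *
          (1 + β * t (-((i : ℕ) : ℤ)))) ^ (n - 1 - (i : ℕ))) *
        (Matrix.of fun i j : Fin n =>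
          facGrothRow β x (shiftSeq (-((j : ℕ) : ℤ)) (fglNeg β t))
            ((μ i : ℤ) - ((i : ℕ) : ℤ) + ((j : ℕ) : ℤ))).det := by
  set w : Fin n → K := fun k => ∏ j ∈ Finset.univ.erase k, (1 + β * x j) / (x k - x j) with hw
  set Q : Matrix (Fin n) (Fin n) K := Matrix.of fun k j : Fin n =>
    ∏ l ∈ Finset.range (j : ℕ), fglAdd β (x k) (fglNeg β t (-(l : ℤ))) with hQ
  -- The factors are the numerator matrix of F_μ, the diagonal matrix of the weights w, and `Q`,
  -- which does not involve μ.
  have hmul : (Matrix.of fun i j : Fin n =>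
        facGrothRow β x (shiftSeq (-((j : ℕ) : ℤ)) (fglNeg β t))
          ((μ i : ℤ) - ((i : ℕ) : ℤ) + ((j : ℕ) : ℤ))) =
      (Matrix.of fun i k : Fin n => facPow β (fglNeg β t) (x k) (μ i + (n - 1 - (i : ℕ)))) *
        Matrix.of fun k j : Fin n => w k * Q k j := by
    ext i j
    have hi := i.2
    have e : ((n : ℤ) + ((μ i : ℤ) - ((i : ℕ) : ℤ) + ((j : ℕ) : ℤ)) - 1).toNat =
        μ i + (n - 1 - (i : ℕ)) + (j : ℕ) := by omega
    rw [Matrix.of_apply, facGrothRow_eq_sum β _ hx i.pos, e, Matrix.mul_apply]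
    refine Finset.sum_congr rfl fun k _ => ?_
    rw [facPow_shiftSeq, Matrix.of_apply, Matrix.of_apply, hQ, Matrix.of_apply]
    ring
  have hQdet : Q.det * ∏ l : Fin n, (1 + β * t (-((l : ℕ) : ℤ))) ^ (n - 1 - (l : ℕ)) =
      (Matrix.vandermonde x).det := det_prod_fglAdd_fglNeg ht x (fun l => -(l : ℤ))
  have hμ : (Matrix.of fun i k : Fin n =>
      facPow β (fglNeg β t) (x k) (μ i + (n - 1 - (i : ℕ)))).det =
        facPowDet β x (fglNeg β t) μ := rfl
  have hVV : vandermondeProd x * (Matrix.vandermonde x).det ≠ 0 := by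
    rw [← prod_prod_erase_sub]
    exact Finset.prod_ne_zero_iff.2 fun i _ => Finset.prod_ne_zero_iff.2 fun j hj =>
      sub_ne_zero.2 fun h => Finset.ne_of_mem_erase hj (hx h).symm
  -- The denominators of all weights multiply to two Vandermonde factors: one matches the
  -- denominator of F_μ, the other det Q.
  have hwprod : (∏ k, w k) * (vandermondeProd x * (Matrix.vandermonde x).det) =
      (∏ i, (1 + β * x i)) ^ (n - 1) := by
    simp only [hw, Finset.prod_div_distrib]
    rw [prod_prod_erase_const, prod_prod_erase_sub, div_mul_cancel₀ _ hVV]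
  have hV := facPowDet_zero_mul ht x
  have hD := facPowDet_zero_ne_zero ht hx
  rw [hmul, Matrix.det_mul, Matrix.det_mul_column, ← hwprod, ← hV, ← hQdet, facF, hμ]
  simp only [mul_pow, Finset.prod_mul_distrib]
  rw [mul_div_assoc', div_eq_iff hD]
  ring

end Row

theorem YoungDiagram.antitone_rowLen (lam : YoungDiagram) (n : ℕ) :
    Antitone fun i : Fin n => lam.rowLen i :=
  fun _ _ h => lam.rowLen_anti _ _ h

theorem mainTheorem9 {K : Type*} [Field K] (n : ℕ) (β : K) (t : ℤ → K)
    (ht : ∀ j : ℤ, 1 + β * t j ≠ 0) (x : Fin n → K) (hx : Function.Injective x)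
    (lam : YoungDiagram) (hlam : lam.colLen 0 ≤ n) :
    -- the denominator of the ratios `F` does not vanish
    facPowDet β x (fglNeg β t) (fun _ => 0) ≠ 0 ∧
    -- the expansion of `G_λ(x|⊖t)`
    facGroth β x (fglNeg β t) lam.cells =
      ∑ α ∈ Fintype.piFinset (fun i : Fin n => Finset.range ((i : ℕ) + 1)),
        β ^ (∑ i, α i) * phiCoeff β t α (fun i => lam.rowLen (i : ℕ)) *
          facF β x (fglNeg β t) (fun i => lam.rowLen (i : ℕ) + α i) ∧
    -- the ratios `F_μ(x|⊖t)` as Jacobi–Trudy determinants in the `G_r`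
    (∀ μ : Fin n → ℕ,
      (∏ i, (1 + β * x i)) ^ (n - 1) * facF β x (fglNeg β t) μ =
        (∏ i : Fin n, ((1 + β * t (((i : ℕ) : ℤ) + 1)) *
            (1 + β * t (-((i : ℕ) : ℤ)))) ^ (n - 1 - (i : ℕ))) *
          (Matrix.of fun i j : Fin n =>
            facGrothRow β x (shiftSeq (-((j : ℕ) : ℤ)) (fglNeg β t))
              ((μ i : ℤ) - ((i : ℕ) : ℤ) + ((j : ℕ) : ℤ))).det) := by
  refine ⟨facPowDet_zero_ne_zero ht hx, ?_, fun μ => pow_mul_facF_eq_det ht hx μ⟩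
  rw [lam.cells_eq_rowCells hlam]
  exact facGroth_rowCells_eq_sum ht hx (lam.antitone_rowLen n)
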